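/- Let $q\in\mathbb{C}$ with $0<|q|<1$, let $q^{1/2}$ be a fixed square root of $q$, and put $q^{-1/2}=1/q^{1/2}$. For a meromorphic function $f$ on $\mathbb{C}$ and $x\in\mathbb{C}\setminus\{\pm1\}$ write $x=(z+1/z)/2$ with $z=x+\sqrt{x^2-1}$, where the branch is such that $\sqrt{x^2-1}\sim x$ as $x\to\infty$ (and $z=x+i\sqrt{1-x^2}$ for $x\in[-1,1]$), put $\breve f(z)=f\big((z+1/z)/2\big)$ and $e(x)=x$. The Askey–Wilson divided difference operator is \[ (\mathcal{D}_qf)(x)=\frac{\breve f(q^{1/2}z)-\breve f(q^{-1/2}z)}{\breve e(q^{1/2}z)-\breve e(q^{-1/2}z)},\qquad (\mathcal{D}_qf)(\pm1)=f'\big(\pm(q^{1/2}+q^{-1/2})/2\big). \] Let $T(r,f)=m(r,f)+N(r,f)$ be the Nevanlinna characteristic, where \[ m(r,f)=\frac1{2\pi}\int_0^{2\pi}\log^+|f(re^{i\theta})|\,d\theta,\qquad N(r,f)=\int_0^r\frac{n(t,f)-n(0,f)}{t}\,dt+n(0,f)\log r \] and $n(t,f)$ is the number of poles of $f$ in $\{|x|\le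 t\}$, counted with multiplicity. The logarithmic order of $f$ is \[ \sigma_{\log}(f)=\limsup_{r\to\infty}\frac{\log T(r,f)}{\log\log r} \] (taken to be $0$ for every constant $f$). Let $f$ be a meromorphic function on $\mathbb{C}$ of finite logarithmic order $\sigma_{\log}=\sigma_{\log}(f)<+\infty$. Then $\mathcal{D}_qf$ is meromorphic on $\mathbb{C}$, and for each $\varepsilon>0$, as $r\to\infty$, \[ N(r,\mathcal{D}_qf)\le 2N(r,f)+O\big((\log r)^{\sigma_{\log}-1+\varepsilon}\big)+O(\log r) \] and \[ T(r,\mathcal{D}_qf)\le 2T(r,f)+O\big((\log r)^{\sigma_{\log}-1+\varepsilon}\big)+O(\log r). \] In particular, $\sigma_{\log}(\mathcal{D}_qf)\le\sigma_{\log}(f)$. -/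

import Mathlib

noncomputable section

/-- The branch `z = x + √(x² - 1)` of the solution of `x = (z + 1/z) / 2` for which
`√(x² - 1) ~ x` as `x → ∞`, holomorphic off `[-1, 1]`, with `z = x + i √(1 - x²)` for
`x ∈ [-1, 1]`. (The square roots are principal ones.) -/
def zBranch (x : ℂ) : ℂ :=
  x + (x - 1) ^ (1 / 2 : ℂ) * (x + 1) ^ (1 / 2 : ℂ)

/-- The function `z ↦ f ((z + 1/z) / 2)`. -/
def breve (f : ℂ → ℂ) (z : ℂ) : ℂ :=
  f ((z + z⁻¹) / 2)

open Classical in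
/-- The Askey-Wilson divided difference operator. Here `s` is the chosen square root of `q`,
so that `s` and `s⁻¹` stand for `q^{1/2}` and `q^{-1/2}`. At `x = ±1`, where the quotient is `0/0`,
the value is that of its limit, `f' (±(q^{1/2} + q^{-1/2}) / 2)`. -/
def askeyWilson (s : ℂ) (f : ℂ → ℂ) (x : ℂ) : ℂ :=
  if x = 1 ∨ x = -1 then
    deriv f (x * ((s + s⁻¹) / 2))
  else
    (breve f (s * zBranch x) - breve f (s⁻¹ * zBranch x)) /
      (breve id (s * zBranch x) - breve id (s⁻¹ * zBranch x))

/-- The logarithmic order `limsup_{r → ∞} log T(r, f) / log log r` of a meromorphic function on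
`ℂ`, an extended real number. (`T(r, f)` vanishes for large `r` only if `f` is a constant of modulus
at most one; by `Real.log 0 = 0` the order is then `0`, as it is for every other constant.) -/
def logOrder (f : ℂ → ℂ) : EReal :=
  Filter.limsup
    (fun r : ℝ =>
      ((Real.log (ValueDistribution.characteristic f ⊤ r) / Real.log (Real.log r) : ℝ) : EReal))
    Filter.atTop

end

/-! Put c = (s + s⁻¹)/2 and d = (s - s⁻¹)/2, so that c² - d² = 1. With w² = x² - 1 the operator
sends f to (f(cx + dw) - f(cx - dw)) / (2dw). This is even in w, so no choice of branch matters. A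
point b is a shift of x exactly when x² - 2cxb + b² + d² = 0, a relation symmetric in x and b. Hence
the points of which b is a shift are the shifts of b, at most two in number
(`shiftPlus_sub_mul_shiftMinus_sub`), and far out |x| and |b| are comparable.

Poles: outside a disk the shifts are locally injective, so the pole order at x is at most the sum of
those of f at the two shifts. Each pole of f is met at most twice, which gives 2N(r, f).
Comparability of |x| and |b| changes each logarithmic weight by O(1), at a total cost O(n(r²))
(`logCounting_le_of_shift`).

Proximity: for large |x| the quotient costs only log 2, and log⁺|f| at each shift must be compared
with log⁺|f(x)|. On the disk of radius r² write log|f| as a sum of D(b) log|x - b| plus log|g| with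
g zero-free. The Poisson formula controls the variation of log|g|, with a factor O(1/r). For a
linear factor the symmetry reads |x₊ - b||x₋ - b| = |x - b₊||x - b₋|, so Jensen's formula computes
the means although the shifts are not holomorphic on the whole disk; each zero or pole costs O(1)
(`circleAverage_shiftDefect_le`), again O(n(r²)) in all.

Finally n(r²) log r² ≤ N(r⁴), applied to zeros and poles together, so n(r²) gains one power of log r
over T (`count_divisor_le_of_logOrder_le`). A nonconstant function has σ ≥ 1, so the error terms do
not raise the order. -/

open Filter Topology Metric

/-! ### The quadratic correspondence underlying the Askey-Wilson operator -/

/-- The square root of `x² - 1` used in `zBranch`. -/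
noncomputable def sqrtBranch (x : ℂ) : ℂ :=
  (x - 1) ^ (1 / 2 : ℂ) * (x + 1) ^ (1 / 2 : ℂ)

/-- The shifted point `c x + d √(x² - 1)`. -/
noncomputable def shiftPlus (c d x : ℂ) : ℂ := c * x + d * sqrtBranch x

/-- The shifted point `c x - d √(x² - 1)`. -/
noncomputable def shiftMinus (c d x : ℂ) : ℂ := c * x - d * sqrtBranch x

/-- `F` is the divided difference of `f` with respect to the shifts `c x ± d √(x² - 1)`. -/
def IsShiftQuotient (c d : ℂ) (f F : ℂ → ℂ) : Prop :=
  ∀ x w : ℂ, w ≠ 0 → w ^ 2 = x ^ 2 - 1 →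
    F x = (f (c * x + d * w) - f (c * x - d * w)) / (2 * d * w)

lemma sq_cpow_half (z : ℂ) : (z ^ (1 / 2 : ℂ)) ^ 2 = z := by
  simp

lemma sqrtBranch_sq (x : ℂ) : sqrtBranch x ^ 2 = x ^ 2 - 1 := by
  rw [sqrtBranch, mul_pow, sq_cpow_half, sq_cpow_half]; ring

lemma norm_sqrtBranch_le (x : ℂ) : ‖sqrtBranch x‖ ≤ ‖x‖ + 1 := by
  have h1 : ‖sqrtBranch x‖ ^ 2 ≤ (‖x‖ + 1) ^ 2 := by
    rw [← norm_pow, sqrtBranch_sq]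
    calc ‖x ^ 2 - 1‖ ≤ ‖x ^ 2‖ + ‖(1 : ℂ)‖ := norm_sub_le _ _
      _ ≤ (‖x‖ + 1) ^ 2 := by rw [norm_pow, norm_one]; nlinarith [norm_nonneg x]
  exact le_of_sq_le_sq h1 (by positivity)

lemma zBranch_eq (x : ℂ) : zBranch x = x + sqrtBranch x := rfl

lemma zBranch_inv (x : ℂ) : (zBranch x)⁻¹ = x - sqrtBranch x := by
  apply inv_eq_of_mul_eq_one_right
  rw [zBranch_eq]
  linear_combination -sqrtBranch_sq x

/-- Since z⁻¹ = x - √(x² - 1), the points sz and s⁻¹z are carried to the two shifts of x. Replacing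
w by -w negates numerator and denominator, so any root may be used. The values at ±1 play no role.
-/
lemma isShiftQuotient_askeyWilson (s : ℂ) (f : ℂ → ℂ) :
    IsShiftQuotient ((s + s⁻¹) / 2) ((s - s⁻¹) / 2) f (askeyWilson s f) := by
  intro x w hw0 hw
  have hx : ¬ (x = 1 ∨ x = -1) := by
    rintro (rfl | rfl) <;> apply hw0 <;> simpa using hw
  rw [askeyWilson, if_neg hx]
  simp only [breve, id, mul_inv, inv_inv, zBranch_inv]
  simp only [zBranch_eq]
  have h1 : (s * (x + sqrtBranch x) + s⁻¹ * (x - sqrtBranch x)) / 2 =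
      (s + s⁻¹) / 2 * x + (s - s⁻¹) / 2 * sqrtBranch x := by ring
  have h2 : (s⁻¹ * (x + sqrtBranch x) + s * (x - sqrtBranch x)) / 2 =
      (s + s⁻¹) / 2 * x - (s - s⁻¹) / 2 * sqrtBranch x := by ring
  rw [h1, h2]
  rcases sq_eq_sq_iff_eq_or_eq_neg.mp ((sqrtBranch_sq x).trans hw.symm) with h | h
  · rw [h]; congr 1; ring
  · rw [h, ← neg_div_neg_eq]
    congr 1
    · rw [neg_sub]; congr 2 <;> ring
    · ring

section Correspondence

variable {c d : ℂ}

/-- Both products equal x² - 2cxb + b² + d², which is symmetric in x and b. This one identity serves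
both the counting of poles and the means of log|x - b|. -/
lemma shiftPlus_sub_mul_shiftMinus_sub (hcd : c ^ 2 - d ^ 2 = 1) (x b : ℂ) :
    (shiftPlus c d x - b) * (shiftMinus c d x - b) =
      (x - shiftPlus c d b) * (x - shiftMinus c d b) := by
  simp only [shiftPlus, shiftMinus]
  linear_combination (-d ^ 2) * sqrtBranch_sq x + d ^ 2 * sqrtBranch_sq b +
    (x ^ 2 - b ^ 2) * hcd

lemma norm_shiftPlus_le (x : ℂ) : ‖shiftPlus c d x‖ ≤ (‖c‖ + ‖d‖) * (‖x‖ + 1) := by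
  calc ‖shiftPlus c d x‖ ≤ ‖c‖ * ‖x‖ + ‖d‖ * ‖sqrtBranch x‖ := by
        rw [← norm_mul, ← norm_mul]; exact norm_add_le _ _
    _ ≤ ‖c‖ * (‖x‖ + 1) + ‖d‖ * (‖x‖ + 1) := by
        gcongr
        · linarith
        · exact norm_sqrtBranch_le x
    _ = _ := by ring

lemma norm_shiftMinus_le (x : ℂ) : ‖shiftMinus c d x‖ ≤ (‖c‖ + ‖d‖) * (‖x‖ + 1) := by
  calc ‖shiftMinus c d x‖ ≤ ‖c‖ * ‖x‖ + ‖d‖ * ‖sqrtBranch x‖ := by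
        rw [← norm_mul, ← norm_mul]; exact norm_sub_le _ _
    _ ≤ ‖c‖ * (‖x‖ + 1) + ‖d‖ * (‖x‖ + 1) := by
        gcongr
        · linarith
        · exact norm_sqrtBranch_le x
    _ = _ := by ring

lemma eq_shift_of_shift_eq (hcd : c ^ 2 - d ^ 2 = 1) {x b : ℂ}
    (h : shiftPlus c d x = b ∨ shiftMinus c d x = b) :
    x = shiftPlus c d b ∨ x = shiftMinus c d b := by
  have h0 : (shiftPlus c d x - b) * (shiftMinus c d x - b) = 0 := by
    rcases h with h | h <;> simp [h]
  rw [shiftPlus_sub_mul_shiftMinus_sub hcd, mul_eq_zero, sub_eq_zero, sub_eq_zero] at h0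
  exact h0

lemma norm_le_of_shift_eq (hcd : c ^ 2 - d ^ 2 = 1) {x b : ℂ}
    (h : shiftPlus c d x = b ∨ shiftMinus c d x = b) :
    ‖x‖ ≤ (‖c‖ + ‖d‖) * (‖b‖ + 1) := by
  rcases eq_shift_of_shift_eq hcd h with h | h
  · rw [h]; exact norm_shiftPlus_le b
  · rw [h]; exact norm_shiftMinus_le b

lemma one_le_norm_add_norm (hcd : c ^ 2 - d ^ 2 = 1) : 1 ≤ ‖c‖ + ‖d‖ := by
  have h : (1 : ℝ) ≤ ‖c‖ ^ 2 + ‖d‖ ^ 2 := by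
    calc (1 : ℝ) = ‖c ^ 2 - d ^ 2‖ := by rw [hcd, norm_one]
      _ ≤ ‖c ^ 2‖ + ‖d ^ 2‖ := norm_sub_le _ _
      _ = _ := by rw [norm_pow, norm_pow]
  nlinarith [norm_nonneg c, norm_nonneg d]

/-- The preimage of a finite set under the shifts is finite. -/
lemma finite_shift_preimage (hcd : c ^ 2 - d ^ 2 = 1) {B : Set ℂ} (hB : B.Finite) :
    {x | shiftPlus c d x ∈ B ∨ shiftMinus c d x ∈ B}.Finite := by
  refine ((hB.image (shiftPlus c d)).union (hB.image (shiftMinus c d))).subset ?_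
  rintro x (hx | hx)
  · rcases eq_shift_of_shift_eq hcd (Or.inl rfl : _ ∨ shiftMinus c d x = _) with h | h
    · exact Or.inl ⟨_, hx, h.symm⟩
    · exact Or.inr ⟨_, hx, h.symm⟩
  · rcases eq_shift_of_shift_eq hcd (Or.inr rfl : shiftPlus c d x = _ ∨ _) with h | h
    · exact Or.inl ⟨_, hx, h.symm⟩
    · exact Or.inr ⟨_, hx, h.symm⟩

/-- The branch of the root is discontinuous across the cut, so continuity is unavailable. Instead,
the shifts are locally bounded and finite sets have finite preimages. -/
lemma shift_preimage_mem_codiscrete (hcd : c ^ 2 - d ^ 2 = 1) {S : Set ℂ}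
    (hS : S ∈ codiscrete ℂ) :
    {x | shiftPlus c d x ∈ S ∧ shiftMinus c d x ∈ S} ∈ codiscrete ℂ := by
  refine mem_codiscreteWithin_iff_forall_mem_nhdsNE.mpr fun x₀ _ => ?_
  simp only [Set.compl_univ, Set.union_empty]
  set K := closedBall (0 : ℂ) ((‖c‖ + ‖d‖) * (‖x₀‖ + 1 + 1)) with hK
  have hfin : (K \ S).Finite := (isCompact_closedBall _ _).finite_sdiff_of_mem_codiscreteWithin
    (codiscreteWithin_mono (Set.subset_univ K) hS)
  have h1 := ((finite_shift_preimage hcd hfin).subset (Set.sdiff_subset (t := {x₀}))).isClosed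
    |>.compl_mem_nhds (x := x₀) (by simp)
  have h2 : ball x₀ 1 ∈ 𝓝 x₀ := ball_mem_nhds _ one_pos
  filter_upwards [nhdsWithin_le_nhds h1, nhdsWithin_le_nhds h2, self_mem_nhdsWithin]
    with x hx1 hx2 hx3
  have hn : ‖x‖ ≤ ‖x₀‖ + 1 := by
    have := norm_sub_norm_le x x₀
    rw [mem_ball, dist_eq_norm] at hx2
    linarith
  have hbad : ¬ (shiftPlus c d x ∈ K \ S ∨ shiftMinus c d x ∈ K \ S) :=
    fun h => hx1 ⟨h, hx3⟩
  have hp : shiftPlus c d x ∈ K := by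
    rw [hK, mem_closedBall_zero_iff]
    exact (norm_shiftPlus_le x).trans (by gcongr)
  have hm : shiftMinus c d x ∈ K := by
    rw [hK, mem_closedBall_zero_iff]
    exact (norm_shiftMinus_le x).trans (by gcongr)
  constructor
  · by_contra h; exact hbad (Or.inl ⟨hp, h⟩)
  · by_contra h; exact hbad (Or.inr ⟨hm, h⟩)

/-! ### Meromorphy and pole orders of shift quotients -/

/-- A local analytic branch of `√(x² - 1)`. -/
lemma exists_analyticAt_sqrt {x₀ : ℂ} (hx₀ : x₀ ^ 2 ≠ 1) :
    ∃ W : ℂ → ℂ, AnalyticAt ℂ W x₀ ∧ (∀ x, W x ^ 2 = x ^ 2 - 1) ∧ W x₀ = sqrtBranch x₀ := by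
  have h0 : x₀ ^ 2 - 1 ≠ 0 := sub_ne_zero.mpr hx₀
  -- The ratio is 1 at x₀, so the principal power is applied away from its cut.
  refine ⟨fun x => sqrtBranch x₀ * ((x ^ 2 - 1) / (x₀ ^ 2 - 1)) ^ (1 / 2 : ℂ), ?_, ?_, ?_⟩
  · refine analyticAt_const.mul (AnalyticAt.cpow (by fun_prop) analyticAt_const ?_)
    rw [div_self h0]
    exact Complex.one_mem_slitPlane
  · intro x
    rw [mul_pow, sq_cpow_half, sqrtBranch_sq]
    field_simp
  · simp [div_self h0]

variable {f F : ℂ → ℂ}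

/-- The shift quotient near a point where `x² ≠ 1`, in terms of an analytic branch. -/
lemma IsShiftQuotient.eventuallyEq (hF : IsShiftQuotient c d f F) {x₀ : ℂ}
    {W : ℂ → ℂ} (hW : AnalyticAt ℂ W x₀) (hW2 : ∀ x, W x ^ 2 = x ^ 2 - 1) (h0 : W x₀ ≠ 0) :
    F =ᶠ[𝓝 x₀] fun x => (f (c * x + d * W x) - f (c * x - d * W x)) / (2 * d * W x) := by
  filter_upwards [hW.continuousAt.eventually_ne h0] with x hx
  exact hF x (W x) hx (hW2 x)

lemma IsShiftQuotient.analyticAt (hd : d ≠ 0) (hF : IsShiftQuotient c d f F) {x₀ : ℂ}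
    (hx₀ : x₀ ^ 2 ≠ 1) (hp : AnalyticAt ℂ f (shiftPlus c d x₀))
    (hm : AnalyticAt ℂ f (shiftMinus c d x₀)) : AnalyticAt ℂ F x₀ := by
  obtain ⟨W, hW, hW2, hWx⟩ := exists_analyticAt_sqrt hx₀
  have h0 : W x₀ ≠ 0 := fun h => hx₀ (by have := hW2 x₀; rw [h] at this; linear_combination -this)
  rw [analyticAt_congr (hF.eventuallyEq hW hW2 h0)]
  have hP : AnalyticAt ℂ (fun x => f (c * x + d * W x)) x₀ :=
    AnalyticAt.fun_comp (f := fun x => c * x + d * W x) (by simpa [hWx, shiftPlus] using hp)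
      (by fun_prop)
  have hM : AnalyticAt ℂ (fun x => f (c * x - d * W x)) x₀ :=
    AnalyticAt.fun_comp (f := fun x => c * x - d * W x) (by simpa [hWx, shiftMinus] using hm)
      (by fun_prop)
  exact (hP.sub hM).div (by fun_prop) (by simp [hd, h0])

lemma IsShiftQuotient.meromorphicAt_of_sq_ne_one (hF : IsShiftQuotient c d f F)
    (hf : Meromorphic f) {x₀ : ℂ} (hx₀ : x₀ ^ 2 ≠ 1) : MeromorphicAt F x₀ := by
  obtain ⟨W, hW, hW2, hWx⟩ := exists_analyticAt_sqrt hx₀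
  have h0 : W x₀ ≠ 0 := fun h => hx₀ (by have := hW2 x₀; rw [h] at this; linear_combination -this)
  refine MeromorphicAt.congr ?_
    ((hF.eventuallyEq hW hW2 h0).symm.filter_mono nhdsWithin_le_nhds)
  have hP : MeromorphicAt (fun x => f (c * x + d * W x)) x₀ :=
    (hf _).comp_analyticAt (g := fun x => c * x + d * W x) (by fun_prop)
  have hM : MeromorphicAt (fun x => f (c * x - d * W x)) x₀ :=
    (hf _).comp_analyticAt (g := fun x => c * x - d * W x) (by fun_prop)
  exact (hP.sub hM).div (AnalyticAt.meromorphicAt (by fun_prop))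

/-- At a branch point w is the local uniformizer: x = x₀√(1 + w²), and F(x) = B(w) with B
meromorphic at w = 0. This bounds F by a power of |x² - 1|. Multiplication by a power of x² - 1
therefore gives a function continuous at x₀ and holomorphic around it, and the singularity is
removable. -/
lemma IsShiftQuotient.meromorphicAt_of_sq_eq_one (hcd : c ^ 2 - d ^ 2 = 1) (hd : d ≠ 0)
    (hF : IsShiftQuotient c d f F) (hf : Meromorphic f) {x₀ : ℂ} (hx₀ : x₀ ^ 2 = 1) :
    MeromorphicAt F x₀ := by
  set X : ℂ → ℂ := fun w => x₀ * (1 + w ^ 2) ^ (1 / 2 : ℂ) with hX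
  have hXan : AnalyticAt ℂ X 0 := by
    refine analyticAt_const.mul (AnalyticAt.cpow (by fun_prop) analyticAt_const ?_)
    simp [Complex.one_mem_slitPlane]
  set B : ℂ → ℂ := fun w => (f (c * X w + d * w) - f (c * X w - d * w)) / (2 * d * w) with hB
  have hBm : MeromorphicAt B 0 := by
    have hP : MeromorphicAt (fun w => f (c * X w + d * w)) 0 :=
      (hf _).comp_analyticAt (g := fun w => c * X w + d * w) (by fun_prop)
    have hM : MeromorphicAt (fun w => f (c * X w - d * w)) 0 :=
      (hf _).comp_analyticAt (g := fun w => c * X w - d * w) (by fun_prop)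
    exact (hP.sub hM).div (AnalyticAt.meromorphicAt (by fun_prop))
  obtain ⟨n, hn⟩ := hBm
  obtain ⟨M, hM⟩ := hn.continuousAt.norm.isBoundedUnder_le
  simp only [sub_zero, smul_eq_mul, eventually_map] at hM
  -- the branch tends to zero
  have hWlim : Tendsto sqrtBranch (𝓝 x₀) (𝓝 0) := by
    have h1 : Tendsto (fun x : ℂ => Real.sqrt ‖x ^ 2 - 1‖) (𝓝 x₀) (𝓝 0) := by
      have : Continuous fun x : ℂ => Real.sqrt ‖x ^ 2 - 1‖ := by fun_prop
      simpa [hx₀] using this.tendsto x₀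
    refine tendsto_zero_iff_norm_tendsto_zero.mpr (h1.congr fun x => ?_)
    rw [← sqrtBranch_sq, norm_pow, Real.sqrt_sq (norm_nonneg _)]
  have hev : ∀ᶠ x in 𝓝 x₀, ‖sqrtBranch x ^ n * B (sqrtBranch x)‖ ≤ M := hWlim.eventually hM
  -- The half-plane fixes the sign: there the principal root of (x₀x)² is x₀x.
  have hre : ∀ᶠ x in 𝓝 x₀, 0 < (x₀ * x).re := by
    have : Continuous fun x : ℂ => (x₀ * x).re := by fun_prop
    have h0 : (fun x : ℂ => (x₀ * x).re) x₀ = 1 := by simp [← sq, hx₀]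
    exact this.continuousAt.eventually (lt_mem_nhds (h0 ▸ one_pos))
  have hXx : ∀ᶠ x in 𝓝 x₀, X (sqrtBranch x) = x := by
    filter_upwards [hre] with x hx
    have h1 : 1 + sqrtBranch x ^ 2 = (x₀ * x) ^ 2 := by rw [sqrtBranch_sq, mul_pow, hx₀]; ring
    have h2 : ((x₀ * x) ^ 2) ^ (1 / 2 : ℂ) = x₀ * x := by
      simpa using Complex.sq_cpow_two_inv hx
    simp only [hX, h1, h2]
    linear_combination x * hx₀
  -- Here (x² - 1)^(n+1) = w^(2n+2). The factor wⁿ makes B bounded, and the remaining w^(n+2) forces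
  -- the limit 0, the value of h at x₀ whatever F is there.
  set h : ℂ → ℂ := fun x => (x ^ 2 - 1) ^ (n + 1) * F x with hh
  have hh0 : h x₀ = 0 := by simp [hh, hx₀]
  have hbound : ∀ᶠ x in 𝓝 x₀, ‖h x‖ ≤ M * ‖sqrtBranch x‖ ^ (n + 2) := by
    filter_upwards [hev, hXx] with x hx1 hx2
    by_cases hw : sqrtBranch x = 0
    · have : x ^ 2 - 1 = 0 := by rw [← sqrtBranch_sq, hw]; simp
      simp [hh, this, hw]
    · have hFx : F x = B (sqrtBranch x) := by
        rw [hF x _ hw (sqrtBranch_sq x)]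
        simp only [hB, hx2]
      calc ‖h x‖ = ‖sqrtBranch x ^ n * B (sqrtBranch x)‖ * ‖sqrtBranch x‖ ^ (n + 2) := by
            simp only [hh]
            rw [← sqrtBranch_sq, hFx, ← norm_pow, ← norm_mul]
            congr 1; ring
        _ ≤ _ := by gcongr
  have hcont : ContinuousAt h x₀ := by
    rw [ContinuousAt, hh0]
    refine squeeze_zero_norm' hbound ?_
    have := ((hWlim.norm).pow (n + 2)).const_mul M
    simpa using this
  have hne : ∀ᶠ x in 𝓝[≠] x₀, x ^ 2 ≠ 1 := by
    have h1 : ∀ᶠ x in 𝓝[≠] x₀, x ≠ -x₀ := by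
      refine eventually_nhdsWithin_of_eventually_nhds (continuousAt_id.eventually_ne ?_)
      intro h
      have : x₀ = 0 := by simpa using self_eq_neg.mp h
      simp [this] at hx₀
    filter_upwards [h1, self_mem_nhdsWithin] with x hx1 hx2 hx3
    rcases sq_eq_sq_iff_eq_or_eq_neg.mp (hx3.trans hx₀.symm) with h | h
    · exact hx2 h
    · exact hx1 h
  have hdiff : ∀ᶠ x in 𝓝[≠] x₀, DifferentiableAt ℂ h x := by
    have hS := shift_preimage_mem_codiscrete hcd
      (hf.meromorphicOn (s := Set.univ)).analyticAt_mem_codiscreteWithin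
    have := mem_codiscreteWithin_iff_forall_mem_nhdsNE.mp hS x₀ (Set.mem_univ _)
    simp only [Set.compl_univ, Set.union_empty] at this
    filter_upwards [this, hne] with x hx1 hx2
    have := (hF.analyticAt hd hx2 hx1.1 hx1.2).differentiableAt
    exact DifferentiableAt.mul (by fun_prop) this
  have han := Complex.analyticAt_of_differentiable_on_punctured_nhds_of_continuousAt hdiff hcont
  have hmer : MeromorphicAt (fun x => h x / (x ^ 2 - 1) ^ (n + 1)) x₀ :=
    han.meromorphicAt.div (AnalyticAt.meromorphicAt (by fun_prop))
  refine hmer.congr ?_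
  filter_upwards [hne] with x hx
  have : x ^ 2 - 1 ≠ 0 := sub_ne_zero.mpr hx
  simp only [hh]
  field_simp

lemma IsShiftQuotient.meromorphic (hcd : c ^ 2 - d ^ 2 = 1) (hd : d ≠ 0)
    (hF : IsShiftQuotient c d f F) (hf : Meromorphic f) : Meromorphic F := by
  intro x
  by_cases hx : x ^ 2 = 1
  · exact hF.meromorphicAt_of_sq_eq_one hcd hd hf hx
  · exact hF.meromorphicAt_of_sq_ne_one hf hx

/-- Away from the branch points, the order of the shift quotient is bounded below by the orders
of `f` at the shifted points. -/
lemma IsShiftQuotient.min_order_le (hcd : c ^ 2 - d ^ 2 = 1) (hd : d ≠ 0)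
    (hF : IsShiftQuotient c d f F) (hf : Meromorphic f) {x₀ : ℂ} (hx₀ : x₀ ^ 2 ≠ 1)
    (hx₀c : x₀ ^ 2 ≠ c ^ 2) :
    min (meromorphicOrderAt f (shiftPlus c d x₀)) (meromorphicOrderAt f (shiftMinus c d x₀)) ≤
      meromorphicOrderAt F x₀ := by
  obtain ⟨W, hW, hW2, hWx⟩ := exists_analyticAt_sqrt hx₀
  have h0 : W x₀ ≠ 0 := fun h => hx₀ (by have := hW2 x₀; rw [h] at this; linear_combination -this)
  have hWd : W x₀ * deriv W x₀ = x₀ := by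
    have h1 : HasDerivAt (fun x => W x ^ 2) (2 * W x₀ * deriv W x₀) x₀ := by
      simpa using hW.differentiableAt.hasDerivAt.fun_pow 2
    have h2 : HasDerivAt (fun x : ℂ => x ^ 2 - 1) (2 * x₀) x₀ := by
      simpa using (hasDerivAt_pow 2 x₀).sub_const 1
    have h3 : (fun x => W x ^ 2) = fun x : ℂ => x ^ 2 - 1 := funext hW2
    rw [h3] at h1
    linear_combination (1 / 2) * h1.unique h2
  -- As W W' = x, a critical point of a shift satisfies c²(x² - 1) = d²x², that is, x² = c².
  -- Elsewhere composition with the shift preserves orders.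
  have hne : ∀ e : ℂ, e ^ 2 = d ^ 2 → c + e * deriv W x₀ ≠ 0 := by
    intro e he h
    apply hx₀c
    have h1 : c * W x₀ = -(e * x₀) := by
      linear_combination W x₀ * h - e * hWd
    have h2 : c ^ 2 * (x₀ ^ 2 - 1) = d ^ 2 * x₀ ^ 2 := by
      rw [← hW2, ← he, ← mul_pow, ← mul_pow, h1]; ring
    linear_combination h2 - x₀ ^ 2 * hcd
  have hPd : deriv (fun x => c * x + d * W x) x₀ ≠ 0 := by
    have : HasDerivAt (fun x => c * x + d * W x) (c * 1 + d * deriv W x₀) x₀ :=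
      ((hasDerivAt_id x₀).const_mul c).add (hW.differentiableAt.hasDerivAt.const_mul d)
    rw [this.deriv, mul_one]
    exact hne d rfl
  have hMd : deriv (fun x => c * x - d * W x) x₀ ≠ 0 := by
    have : HasDerivAt (fun x => c * x - d * W x) (c * 1 - d * deriv W x₀) x₀ :=
      ((hasDerivAt_id x₀).const_mul c).sub (hW.differentiableAt.hasDerivAt.const_mul d)
    rw [this.deriv, mul_one, sub_eq_add_neg, ← neg_mul]
    exact hne (-d) (by ring)
  have hPm : MeromorphicAt (f ∘ fun x => c * x + d * W x) x₀ :=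
    (hf _).comp_analyticAt (by fun_prop)
  have hMm : MeromorphicAt (f ∘ fun x => c * x - d * W x) x₀ :=
    (hf _).comp_analyticAt (by fun_prop)
  have hPo := meromorphicOrderAt_comp_of_deriv_ne_zero (f := f)
    (g := fun x => c * x + d * W x) (by fun_prop) hPd
  have hMo := meromorphicOrderAt_comp_of_deriv_ne_zero (f := f)
    (g := fun x => c * x - d * W x) (by fun_prop) hMd
  have hFe : F =ᶠ[𝓝[≠] x₀] (fun x => (2 * d * W x)⁻¹) *
      ((f ∘ fun x => c * x + d * W x) + -(f ∘ fun x => c * x - d * W x)) := by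
    refine ((hF.eventuallyEq hW hW2 h0).filter_mono nhdsWithin_le_nhds).trans ?_
    refine Eventually.of_forall fun x => ?_
    simp only [Pi.mul_apply, Pi.add_apply, Pi.neg_apply, Function.comp]
    rw [div_eq_mul_inv, mul_comm, sub_eq_add_neg]
  rw [meromorphicOrderAt_congr hFe, meromorphicOrderAt_mul_of_ne_zero
    ((by fun_prop : AnalyticAt ℂ (fun x => 2 * d * W x) x₀).fun_inv (by simp [hd, h0]))
    (by simp [hd, h0])]
  refine le_trans ?_ (meromorphicOrderAt_add hPm hMm.neg)
  rw [← meromorphicOrderAt_neg (f := f ∘ fun x => c * x - d * W x), hPo, hMo, hWx]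
  exact le_rfl

end Correspondence

/-! ### Counting functions of divisors -/

namespace Function.locallyFinsuppWithin

open Real

/-- The points of the support of `D` in the closed disk of radius `r`. -/
noncomputable def ballSupport (D : locallyFinsupp ℂ ℤ) (r : ℝ) : Finset ℂ :=
  ((toClosedBall r D).finiteSupport (isCompact_closedBall 0 |r|)).toFinset

/-- The unintegrated counting function of `D`. -/
noncomputable def count (D : locallyFinsupp ℂ ℤ) (r : ℝ) : ℝ :=
  ∑ z ∈ D.ballSupport r, (D z : ℝ)

/-- The weight with which a point contributes to the logarithmic counting function. -/
noncomputable def logWeight (r : ℝ) (z : ℂ) : ℝ :=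
  log (r * ‖z‖⁻¹) + if z = 0 then log r else 0

lemma mem_ballSupport {D : locallyFinsupp ℂ ℤ} {r : ℝ} (hr : 0 ≤ r) {z : ℂ} :
    z ∈ D.ballSupport r ↔ ‖z‖ ≤ r ∧ D z ≠ 0 := by
  rw [ballSupport, Set.Finite.mem_toFinset, Function.mem_support]
  by_cases hz : z ∈ closedBall (0 : ℂ) |r|
  · rw [toClosedBall_eval_within _ hz]
    rw [mem_closedBall_zero_iff, abs_of_nonneg hr] at hz
    simp [hz]
  · rw [apply_eq_zero_of_notMem _ hz]
    rw [mem_closedBall_zero_iff, abs_of_nonneg hr] at hz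
    simp [hz]

lemma ballSupport_mono (D : locallyFinsupp ℂ ℤ) {r R : ℝ} (hr : 0 ≤ r) (hrR : r ≤ R) :
    D.ballSupport r ⊆ D.ballSupport R := by
  intro z hz
  rw [mem_ballSupport hr] at hz
  rw [mem_ballSupport (hr.trans hrR)]
  exact ⟨hz.1.trans hrR, hz.2⟩

lemma logCounting_eq_sum (D : locallyFinsupp ℂ ℤ) {r : ℝ} (hr : 0 ≤ r) :
    logCounting D r = ∑ z ∈ D.ballSupport r, (D z : ℝ) * logWeight r z := by
  have h1 : logCounting D r =
      ∑ᶠ z, (toClosedBall r D z : ℝ) * log (r * ‖z‖⁻¹) + (D 0) * log r := rfl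
  rw [h1, finsum_eq_sum_of_support_subset (s := D.ballSupport r)]
  · have h2 : (D 0 : ℝ) * log r =
        ∑ z ∈ D.ballSupport r, (if z = 0 then (D z : ℝ) * log r else 0) := by
      rw [Finset.sum_ite_eq']
      split_ifs with h
      · rfl
      · have : D 0 = 0 := by
          by_contra h0
          exact h ((mem_ballSupport hr).mpr ⟨by simpa using hr, h0⟩)
        simp [this]
    rw [h2, ← Finset.sum_add_distrib]
    refine Finset.sum_congr rfl fun z hz => ?_
    have hz' := (mem_ballSupport hr).mp hz
    rw [toClosedBall_eval_within _
      (by rw [mem_closedBall_zero_iff, abs_of_nonneg hr]; exact hz'.1), logWeight, mul_add]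
    congr 1
    split_ifs <;> simp
  · intro z hz
    have : toClosedBall r D z ≠ 0 := by
      intro h
      simp [h] at hz
    rw [Finset.mem_coe, ballSupport, Set.Finite.mem_toFinset]
    exact this

lemma logWeight_nonneg {r : ℝ} {z : ℂ} (hr : 1 ≤ r) (hz : ‖z‖ ≤ r) : 0 ≤ logWeight r z := by
  rw [logWeight]
  split_ifs with h
  · simp [h, log_nonneg hr]
  · have hz0 : 0 < ‖z‖ := norm_pos_iff.mpr h
    rw [add_zero]
    apply log_nonneg
    rw [← div_eq_mul_inv, le_div_iff₀ hz0]
    linarith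

lemma posLog_le_logWeight {r : ℝ} {z : ℂ} (hr : 1 ≤ r) (hz : ‖z‖ ≤ r) :
    log⁺ (r * ‖z‖⁻¹) ≤ logWeight r z := by
  rw [posLog_def]
  refine max_le (logWeight_nonneg hr hz) ?_
  rw [logWeight]
  have := log_nonneg hr
  split_ifs <;> linarith

lemma log_le_logWeight_sq {R : ℝ} {z : ℂ} (hR : 1 ≤ R) (hz : ‖z‖ ≤ R) :
    log R ≤ logWeight (R ^ 2) z := by
  have h0 : 0 ≤ log R := log_nonneg hR
  rw [logWeight]
  split_ifs with h
  · rw [h, log_pow]; push_cast; simp; linarith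
  · have hz0 : 0 < ‖z‖ := norm_pos_iff.mpr h
    rw [add_zero]
    apply log_le_log (by linarith)
    rw [← div_eq_mul_inv, le_div_iff₀ hz0]
    nlinarith

lemma logWeight_le {r : ℝ} (hr : 1 ≤ r) (z : ℂ) : logWeight r z ≤ log r + |log ‖z‖| := by
  rw [logWeight]
  split_ifs with h
  · simp [h]
  · rw [log_mul (by linarith) (inv_ne_zero (norm_ne_zero_iff.mpr h)), log_inv]
    linarith [neg_le_abs (log ‖z‖)]

lemma count_nonneg {D : locallyFinsupp ℂ ℤ} (hD : 0 ≤ D) (r : ℝ) : 0 ≤ D.count r :=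
  Finset.sum_nonneg fun z _ => by exact_mod_cast hD z

lemma count_add (D E : locallyFinsupp ℂ ℤ) {r : ℝ} (hr : 0 ≤ r) :
    (D + E).count r = D.count r + E.count r := by
  have h : ∀ D' : locallyFinsupp ℂ ℤ, ∀ S : Finset ℂ, (∀ z ∈ S, ‖z‖ ≤ r) →
      D'.ballSupport r ⊆ S → D'.count r = ∑ z ∈ S, (D' z : ℝ) := by
    intro D' S hS hsub
    refine Finset.sum_subset hsub fun z hz hz' => ?_
    by_contra h0
    exact hz' ((mem_ballSupport hr).mpr ⟨hS z hz, by exact_mod_cast h0⟩)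
  classical
  set S := (D + E).ballSupport r ∪ D.ballSupport r ∪ E.ballSupport r with hS
  have hSn : ∀ z ∈ S, ‖z‖ ≤ r := by
    intro z hz
    simp only [hS, Finset.mem_union, mem_ballSupport hr] at hz
    tauto
  rw [h (D + E) S hSn (by intro z hz; simp [hS, hz]), h D S hSn (by intro z hz; simp [hS, hz]),
    h E S hSn (by intro z hz; simp [hS, hz]), ← Finset.sum_add_distrib]
  simp

/-- Each point of the disk of radius R has weight at least log R at radius R². -/
lemma count_mul_log_le {D : locallyFinsupp ℂ ℤ} (hD : 0 ≤ D) {R : ℝ} (hR : 1 ≤ R) :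
    D.count R * log R ≤ logCounting D (R ^ 2) := by
  have hR2 : R ≤ R ^ 2 := by nlinarith
  rw [logCounting_eq_sum D (by positivity), count, Finset.sum_mul]
  have hD' : ∀ z, (0 : ℝ) ≤ D z := fun z => by exact_mod_cast hD z
  calc ∑ z ∈ D.ballSupport R, (D z : ℝ) * log R
      ≤ ∑ z ∈ D.ballSupport R, (D z : ℝ) * logWeight (R ^ 2) z := by
        refine Finset.sum_le_sum fun z hz => mul_le_mul_of_nonneg_left ?_ (hD' z)
        exact log_le_logWeight_sq hR ((mem_ballSupport (by linarith)).mp hz).1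
    _ ≤ _ := by
        refine Finset.sum_le_sum_of_subset_of_nonneg (ballSupport_mono D (by linarith) hR2)
          fun z hz _ => mul_nonneg (hD' z) (logWeight_nonneg (by linarith) ?_)
        exact ((mem_ballSupport (by positivity)).mp hz).1

/-- The contribution of a fixed disk to the logarithmic counting function is `O(log r)`. -/
lemma exists_sum_logWeight_le {D : locallyFinsupp ℂ ℤ} (hD : 0 ≤ D) {B : ℝ} (hB : 0 ≤ B) :
    ∃ C, 0 ≤ C ∧ ∀ r, exp 1 ≤ r →
      ∑ z ∈ D.ballSupport r with ‖z‖ ≤ B, (D z : ℝ) * logWeight r z ≤ C * log r := by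
  have hD' : ∀ z, (0 : ℝ) ≤ D z := fun z => by exact_mod_cast hD z
  refine ⟨∑ z ∈ D.ballSupport B, (D z : ℝ) * (1 + |log ‖z‖|),
    Finset.sum_nonneg fun z _ => mul_nonneg (hD' z) (by positivity), fun r hr => ?_⟩
  have hr1 : 1 ≤ r := (one_le_exp zero_le_one).trans hr
  have hlr : 1 ≤ log r := by rwa [le_log_iff_exp_le (by linarith)]
  rw [Finset.sum_mul]
  calc ∑ z ∈ D.ballSupport r with ‖z‖ ≤ B, (D z : ℝ) * logWeight r z
      ≤ ∑ z ∈ D.ballSupport r with ‖z‖ ≤ B, (D z : ℝ) * (1 + |log ‖z‖|) * log r := by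
        refine Finset.sum_le_sum fun z _ => ?_
        rw [mul_assoc]
        refine mul_le_mul_of_nonneg_left ((logWeight_le hr1 z).trans ?_) (hD' z)
        nlinarith [abs_nonneg (log ‖z‖)]
    _ ≤ _ := by
        refine Finset.sum_le_sum_of_subset_of_nonneg ?_ fun z _ _ =>
          mul_nonneg (mul_nonneg (hD' z) (by positivity)) (by linarith)
        intro z hz
        rw [Finset.mem_filter, mem_ballSupport (by linarith)] at hz
        exact (mem_ballSupport hB).mpr ⟨hz.2, hz.1.2⟩

end Function.locallyFinsuppWithin

open Function.locallyFinsuppWithin Real in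
/-- If every point `x` off a disk has multiplicity at most that of its two shifts, then the
logarithmic counting function at most doubles, up to lower order terms. -/
lemma logCounting_le_of_shift {c d : ℂ} (hcd : c ^ 2 - d ^ 2 = 1) (hd : d ≠ 0)
    {D E : Function.locallyFinsupp ℂ ℤ} (hD : 0 ≤ D) (hE : 0 ≤ E) {B₀ : ℝ}
    (h : ∀ x, B₀ < ‖x‖ → D x ≤ E (shiftPlus c d x) + E (shiftMinus c d x)) :
    ∃ C, 0 ≤ C ∧ ∀ᶠ r : ℝ in atTop, logCounting D r ≤
      2 * logCounting E r + C * E.count (r ^ 2) + C * log r := by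
  classical
  set K := ‖c‖ + ‖d‖ with hK
  have hK1 : 1 ≤ K := one_le_norm_add_norm hcd
  -- Beyond 4K the additive constants in the norm bounds are absorbed: ‖b‖ ≤ 2K‖x‖, and no shift is
  -- 0.
  set B := max B₀ (4 * K) with hB
  have hB4 : 4 * K ≤ B := le_max_right _ _
  have hE' : ∀ z, (0 : ℝ) ≤ E z := fun z => by exact_mod_cast hE z
  obtain ⟨C₁, hC₁, hC₁'⟩ := exists_sum_logWeight_le hD (B := B) (by linarith)
  have hlogK : 0 ≤ log (2 * K) := log_nonneg (by linarith)
  refine ⟨max C₁ (2 * log (2 * K)), le_max_of_le_left hC₁, ?_⟩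
  filter_upwards [eventually_ge_atTop (exp 1), eventually_ge_atTop (4 * K)] with r hre hrK
  have hr1 : 1 ≤ r := (one_le_exp zero_le_one).trans hre
  have hr0 : 0 ≤ r := by linarith
  have hlr : 0 ≤ log r := log_nonneg hr1
  have hrr : r ≤ r ^ 2 := by nlinarith
  rw [logCounting_eq_sum D hr0, ← Finset.sum_filter_add_sum_filter_not _ (fun z => ‖z‖ ≤ B)]
  set X := (D.ballSupport r).filter (fun z => ¬ ‖z‖ ≤ B) with hX
  -- The weight of x is moved to its shift b at a loss of log (2K). Since b may leave the disk of
  -- radius r, though not that of radius r², `log⁺` is needed.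
  set g : ℂ → ℝ := fun b => (E b : ℝ) * (log (2 * K) + log⁺ (r * ‖b‖⁻¹)) with hg
  have hg0 : ∀ b, 0 ≤ g b := fun b => mul_nonneg (hE' b) (add_nonneg hlogK posLog_nonneg)
  have hXmem : ∀ x ∈ X, ‖x‖ ≤ r ∧ B < ‖x‖ := by
    intro x hx
    rw [hX, Finset.mem_filter, mem_ballSupport hr0, not_le] at hx
    exact ⟨hx.1.1, hx.2⟩
  -- size of the shifts
  have hsize : ∀ x ∈ X, ∀ b, (shiftPlus c d x = b ∨ shiftMinus c d x = b) →
      ‖b‖ ≤ r ^ 2 ∧ logWeight r x ≤ log (2 * K) + log⁺ (r * ‖b‖⁻¹) := by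
    intro x hx b hb
    obtain ⟨hx1, hx2⟩ := hXmem x hx
    have hb1 : ‖b‖ ≤ K * (‖x‖ + 1) := by
      rcases hb with hb | hb
      · rw [← hb]; exact norm_shiftPlus_le x
      · rw [← hb]; exact norm_shiftMinus_le x
    have hb2 : ‖x‖ ≤ K * (‖b‖ + 1) := norm_le_of_shift_eq hcd hb
    have hb3 : ‖b‖ ≤ 2 * K * ‖x‖ := by nlinarith
    have hb4 : 0 < ‖b‖ := by
      by_contra hneg
      have : ‖b‖ = 0 := le_antisymm (not_lt.mp hneg) (norm_nonneg b)
      rw [this] at hb2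
      linarith
    have hx0 : x ≠ 0 := by
      rintro rfl
      rw [norm_zero] at hx2
      linarith
    have hxp : 0 < ‖x‖ := norm_pos_iff.mpr hx0
    refine ⟨by nlinarith, ?_⟩
    rw [logWeight, if_neg hx0, add_zero]
    calc log (r * ‖x‖⁻¹) ≤ log ((2 * K) * (r * ‖b‖⁻¹)) := by
          apply log_le_log (by positivity)
          rw [← div_eq_mul_inv, ← div_eq_mul_inv, ← mul_div_assoc,
            div_le_div_iff₀ hxp hb4]
          nlinarith
      _ = log (2 * K) + log (r * ‖b‖⁻¹) := by
          rw [log_mul (by positivity) (by positivity)]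
      _ ≤ _ := by gcongr; exact le_max_right _ _
  have step1 : ∑ x ∈ X, (D x : ℝ) * logWeight r x ≤
      ∑ x ∈ X, (g (shiftPlus c d x) + g (shiftMinus c d x)) := by
    refine Finset.sum_le_sum fun x hx => ?_
    obtain ⟨hx1, hx2⟩ := hXmem x hx
    have hDx : (D x : ℝ) ≤ E (shiftPlus c d x) + E (shiftMinus c d x) := by
      exact_mod_cast h x ((le_max_left _ _).trans_lt hx2)
    have hw := logWeight_nonneg hr1 hx1
    calc (D x : ℝ) * logWeight r x
        ≤ (E (shiftPlus c d x) + E (shiftMinus c d x)) * logWeight r x := by gcongr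
      _ = E (shiftPlus c d x) * logWeight r x + E (shiftMinus c d x) * logWeight r x := by ring
      _ ≤ _ := add_le_add
          (mul_le_mul_of_nonneg_left (hsize x hx _ (Or.inl rfl)).2 (hE' _))
          (mul_le_mul_of_nonneg_left (hsize x hx _ (Or.inr rfl)).2 (hE' _))
  set S := E.ballSupport (r ^ 2) with hS
  have hgsum : ∀ b, ‖b‖ ≤ r ^ 2 → g b = ∑ b' ∈ S, if b = b' then g b' else 0 := by
    intro b hb
    rw [Finset.sum_ite_eq]
    split_ifs with hbS
    · rfl
    · have : E b = 0 := by
        by_contra h0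
        exact hbS ((mem_ballSupport (by positivity)).mpr ⟨hb, h0⟩)
      simp [hg, this]
  -- Double counting: the two shifts of x are distinct because x² ≠ 1, and each b is a shift of at
  -- most two points.
  have step2 : ∑ x ∈ X, (g (shiftPlus c d x) + g (shiftMinus c d x)) ≤ 2 * ∑ b ∈ S, g b := by
    calc ∑ x ∈ X, (g (shiftPlus c d x) + g (shiftMinus c d x))
        = ∑ x ∈ X, ∑ b ∈ S,
          (if shiftPlus c d x = b ∨ shiftMinus c d x = b then g b else 0) := by
          refine Finset.sum_congr rfl fun x hx => ?_
          rw [hgsum _ (hsize x hx _ (Or.inl rfl)).1, hgsum _ (hsize x hx _ (Or.inr rfl)).1,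
            ← Finset.sum_add_distrib]
          refine Finset.sum_congr rfl fun b _ => ?_
          have hne : shiftPlus c d x ≠ shiftMinus c d x := by
            intro heq
            have h1 : 2 * d * sqrtBranch x = 0 := by
              simp only [shiftPlus, shiftMinus] at heq
              linear_combination heq
            have h2 : sqrtBranch x = 0 := by simpa [hd] using h1
            have h3 : x ^ 2 = 1 := by
              have := sqrtBranch_sq x
              rw [h2] at this
              linear_combination -this
            have h4 : ‖x‖ ^ 2 = 1 := by rw [← norm_pow, h3, norm_one]
            have := (hXmem x hx).2
            nlinarith
          by_cases h1 : shiftPlus c d x = b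
          · have h2 : shiftMinus c d x ≠ b := fun h2 => hne (h1.trans h2.symm)
            simp [h1, h2]
          · simp [h1]
      _ = ∑ b ∈ S, ∑ x ∈ X,
          (if shiftPlus c d x = b ∨ shiftMinus c d x = b then g b else 0) := Finset.sum_comm
      _ ≤ ∑ b ∈ S, 2 * g b := by
          refine Finset.sum_le_sum fun b _ => ?_
          rw [← Finset.sum_filter, Finset.sum_const, nsmul_eq_mul]
          refine mul_le_mul_of_nonneg_right ?_ (hg0 b)
          have hsub : (X.filter fun x => shiftPlus c d x = b ∨ shiftMinus c d x = b) ⊆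
              {shiftPlus c d b, shiftMinus c d b} := by
            intro x hx
            rw [Finset.mem_filter] at hx
            simpa using eq_shift_of_shift_eq hcd hx.2
          exact_mod_cast (Finset.card_le_card hsub).trans Finset.card_le_two
      _ = _ := by rw [Finset.mul_sum]
  have step3 : ∑ b ∈ S, g b ≤ log (2 * K) * E.count (r ^ 2) + logCounting E r := by
    simp only [hg, mul_add]
    rw [Finset.sum_add_distrib]
    refine add_le_add (by rw [← Finset.sum_mul, mul_comm, count]) ?_
    rw [logCounting_eq_sum E hr0, ← Finset.sum_subset (ballSupport_mono E hr0 hrr)]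
    · refine Finset.sum_le_sum fun z hz => mul_le_mul_of_nonneg_left ?_ (hE' z)
      exact posLog_le_logWeight hr1 ((mem_ballSupport hr0).mp hz).1
    · intro z hz hz'
      rw [mem_ballSupport (by positivity)] at hz
      have hzr : r < ‖z‖ := by
        by_contra hneg
        exact hz' ((mem_ballSupport hr0).mpr ⟨not_lt.mp hneg, hz.2⟩)
      have : log⁺ (r * ‖z‖⁻¹) = 0 := by
        rw [posLog_eq_zero_iff, abs_of_nonneg (by positivity), ← div_eq_mul_inv,
          div_le_one (by linarith)]
        exact hzr.le
      rw [this, mul_zero]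
  have hcn := count_nonneg hE (r ^ 2)
  have e1 : C₁ * log r ≤ max C₁ (2 * log (2 * K)) * log r := by
    gcongr; exact le_max_left _ _
  have e2 : 2 * log (2 * K) * E.count (r ^ 2) ≤
      max C₁ (2 * log (2 * K)) * E.count (r ^ 2) := by
    gcongr; exact le_max_right _ _
  linarith [hC₁' r hre]

lemma negPart_untop₀_le_of_le {a b : WithTop ℤ} (h : a ≤ b) : (b.untop₀)⁻ ≤ (a.untop₀)⁻ := by
  induction b with
  | top => simp
  | coe b =>
    induction a with
    | top => simp at h
    | coe a => simpa using negPart_anti (by exact_mod_cast h : a ≤ b)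

open Function.locallyFinsuppWithin Real ValueDistribution MeromorphicOn in
/-- The logarithmic counting function of the poles of a shift quotient. -/
lemma IsShiftQuotient.logCounting_top_le {c d : ℂ} (hcd : c ^ 2 - d ^ 2 = 1) (hd : d ≠ 0)
    {f F : ℂ → ℂ} (hF : IsShiftQuotient c d f F) (hf : Meromorphic f) :
    ∃ C, 0 ≤ C ∧ ∀ᶠ r : ℝ in atTop, ValueDistribution.logCounting F ⊤ r ≤
      2 * ValueDistribution.logCounting f ⊤ r
        + C * (divisor f Set.univ)⁻.count (r ^ 2) + C * log r := by
  simp only [logCounting_top]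
  -- Outside this disk neither x² = 1 nor x² = c² occurs, so the comparison of orders applies.
  refine logCounting_le_of_shift hcd hd (negPart_nonneg _) (negPart_nonneg _)
    (B₀ := max 1 ‖c‖) fun x hx => ?_
  have hx1 : 1 < ‖x‖ := (le_max_left _ _).trans_lt hx
  have hxc : ‖c‖ < ‖x‖ := (le_max_right _ _).trans_lt hx
  have h1 : x ^ 2 ≠ 1 := by
    intro h
    have : ‖x‖ ^ 2 = 1 := by rw [← norm_pow, h, norm_one]
    nlinarith
  have h2 : x ^ 2 ≠ c ^ 2 := by
    intro h
    have : ‖x‖ ^ 2 = ‖c‖ ^ 2 := by rw [← norm_pow, h, norm_pow]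
    nlinarith [norm_nonneg c]
  have hFm := hF.meromorphic hcd hd hf
  have ho := hF.min_order_le hcd hd hf h1 h2
  simp only [negPart_apply]
  rw [divisor_apply hFm.meromorphicOn (Set.mem_univ _),
    divisor_apply hf.meromorphicOn (Set.mem_univ _),
    divisor_apply hf.meromorphicOn (Set.mem_univ _)]
  have hP := negPart_nonneg (meromorphicOrderAt f (shiftPlus c d x)).untop₀
  have hM := negPart_nonneg (meromorphicOrderAt f (shiftMinus c d x)).untop₀
  rcases min_le_iff.mp ho with h | h
  · linarith [negPart_untop₀_le_of_le h]
  · linarith [negPart_untop₀_le_of_le h]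

/-! ### Circle averages -/

namespace Real

lemma posLog_le_posLog_add_abs (a b : ℝ) :
    log⁺ a ≤ log⁺ b + |log a - log b| := by
  have h1 := le_abs_self (log a - log b)
  have h2 := abs_nonneg (log a - log b)
  have h3 : 0 ≤ log⁺ b := posLog_nonneg
  have h4 : log b ≤ log⁺ b := le_max_right _ _
  exact max_le (by linarith) (by linarith)

lemma circleAverage_mono_codiscreteWithin {c : ℂ} {R : ℝ} (hR : R ≠ 0) {f₁ f₂ : ℂ → ℝ}
    (hf₁ : CircleIntegrable f₁ c R) (hf₂ : CircleIntegrable f₂ c R)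
    (h : ∀ᶠ x in codiscreteWithin (sphere c |R|), f₁ x ≤ f₂ x) :
    circleAverage f₁ c R ≤ circleAverage f₂ c R := by
  have he : f₁ =ᶠ[codiscreteWithin (sphere c |R|)] fun x => min (f₁ x) (f₂ x) := by
    filter_upwards [h] with x hx
    exact (min_eq_left hx).symm
  rw [circleAverage_congr_codiscreteWithin he hR]
  exact circleAverage_mono (hf₁.congr_codiscreteWithin he) hf₂ fun x _ => min_le_right _ _

lemma circleIntegrable_log_norm_sub (a c : ℂ) (R : ℝ) :
    CircleIntegrable (fun x => log ‖x - a‖) c R :=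
  MeromorphicOn.circleIntegrable_log_norm (f := fun x => x - a)
    fun x _ => AnalyticAt.meromorphicAt (by fun_prop)

/-- By Jensen's formula the mean of log|x - a| on the circle is log max(r, |a|). -/
lemma log_le_log_add_circleAverage {r A t : ℝ} {a : ℂ} (hr : 0 < r) (hA : 0 < A) (ht : 0 < t)
    (h : t ≤ A * max r ‖a‖) :
    log t ≤ log A + circleAverage (fun x => log ‖x - a‖) 0 r := by
  rw [circleAverage_log_norm_sub_const_eq_log_radius_add_posLog hr.ne', zero_sub, norm_neg]
  have hm : 0 < max r ‖a‖ := lt_max_of_lt_left hr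
  have h1 : log t ≤ log A + log (max r ‖a‖) := by
    rw [← log_mul hA.ne' hm.ne']
    exact log_le_log ht h
  refine h1.trans (add_le_add le_rfl ?_)
  rcases max_cases r ‖a‖ with ⟨h2, _⟩ | ⟨h2, h3⟩
  · rw [h2]; linarith [posLog_nonneg (x := r⁻¹ * ‖a‖)]
  · rw [h2]
    have : log (r⁻¹ * ‖a‖) ≤ log⁺ (r⁻¹ * ‖a‖) := le_max_right _ _
    rw [log_mul (inv_ne_zero hr.ne') (by linarith), log_inv] at this
    linarith

/-- From t ≤ L and L ≥ 0 follows |t| ≤ 2L - t. With L = log (2R) and mean log R, the result is 2 log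
(2R) - log R = log (4R). -/
lemma circleAverage_abs_log_norm_sub_le {R : ℝ} {b : ℂ} (hR : 1 ≤ R) (hb : ‖b‖ ≤ R) :
    circleAverage (fun x => |log ‖x - b‖|) 0 R ≤ log (4 * R) := by
  have hR0 : 0 < R := by linarith
  have hi := circleIntegrable_log_norm_sub b 0 R
  have h1 : circleAverage (fun x => |log ‖x - b‖|) 0 R ≤
      circleAverage (fun x => 2 * log (2 * R) - log ‖x - b‖) 0 R := by
    refine circleAverage_mono hi.abs ((circleIntegrable_const _ _ _).sub hi) fun x hx => ?_
    rw [abs_of_pos hR0, mem_sphere_zero_iff_norm] at hx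
    have h2 : ‖x - b‖ ≤ 2 * R := (norm_sub_le _ _).trans (by linarith)
    have h3 : 0 ≤ log (2 * R) := log_nonneg (by linarith)
    have h4 : log ‖x - b‖ ≤ log (2 * R) := by
      rcases (norm_nonneg (x - b)).eq_or_lt with h | h
      · rw [← h, log_zero]; exact h3
      · exact log_le_log h h2
    rw [abs_le]
    constructor <;> linarith
  refine h1.trans (le_of_eq ?_)
  rw [circleAverage_fun_sub (circleIntegrable_const _ _ _) hi, circleAverage_const,
    circleAverage_log_norm_sub_const_of_mem_closedBall
      (by rwa [mem_closedBall_zero_iff, abs_of_pos hR0]),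
    log_mul two_ne_zero hR0.ne', log_mul four_ne_zero hR0.ne',
    show (4 : ℝ) = 2 ^ 2 by norm_num, log_pow]
  push_cast
  ring

/-- A quantitative Lipschitz estimate for `log ‖g‖` where `g` has no zeros. -/
lemma abs_log_norm_sub_log_norm_le {g : ℂ → ℂ} {R : ℝ} (hR : 0 < R)
    (hg : AnalyticOnNhd ℂ g (closedBall 0 R)) (hg0 : ∀ z ∈ closedBall (0 : ℂ) R, g z ≠ 0)
    {x y : ℂ} (hx : ‖x‖ ≤ R / 2) (hy : ‖y‖ ≤ R / 2) :
    |log ‖g y‖ - log ‖g x‖| ≤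
      8 * ‖y - x‖ / R * circleAverage (fun z => |log ‖g z‖|) 0 R := by
  have hharm : InnerProductSpace.HarmonicOnNhd (fun z => log ‖g z‖) (closedBall 0 R) :=
    fun z hz => (hg z hz).harmonicAt_log_norm (hg0 z hz)
  have hball : ∀ z : ℂ, ‖z‖ ≤ R / 2 → z ∈ ball (0 : ℂ) R := fun z hz => by
    rw [mem_ball_zero_iff]; linarith
  -- Poisson's formula at both points reduces the claim to a bound for the difference of the
  -- kernels.
  have hyI := hharm.circleAverage_re_herglotzRieszKernel_smul (hball y hy)
  have hxI := hharm.circleAverage_re_herglotzRieszKernel_smul (hball x hx)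
  have hgi : CircleIntegrable (fun z => log ‖g z‖) 0 R :=
    MeromorphicOn.circleIntegrable_log_norm fun z hz =>
      (hg z (by rw [abs_of_pos hR] at hz; exact sphere_subset_closedBall hz)).meromorphicAt
  have hcont : ContinuousOn (fun z => log ‖g z‖) (sphere 0 R) := fun z hz =>
    ((hg z (sphere_subset_closedBall hz)).continuousAt.norm.log
      (norm_ne_zero_iff.mpr (hg0 z (sphere_subset_closedBall hz)))).continuousWithinAt
  have hker : ∀ w : ℂ, ‖w‖ ≤ R / 2 →
      CircleIntegrable ((Complex.re ∘ herglotzRieszKernel 0 w) • fun z => log ‖g z‖) 0 R := by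
    intro w hw
    refine ContinuousOn.circleIntegrable' ?_
    exact (Complex.continuous_re.comp_continuousOn
      (continuousOn_herglotzRieszKernel_sphere (hball w hw))).smul
      (by rwa [abs_of_pos hR])
  rw [← hyI, ← hxI, ← circleAverage_sub (hker y hy) (hker x hx)]
  refine abs_circleAverage_le_circleAverage_abs.trans ?_
  rw [← smul_eq_mul (a := 8 * ‖y - x‖ / R), ← circleAverage_fun_smul]
  refine circleAverage_mono ((hker y hy).sub (hker x hx)).abs
    (hgi.abs.const_smul (a := 8 * ‖y - x‖ / R)) fun z hz => ?_
  rw [abs_of_pos hR, mem_sphere_zero_iff_norm] at hz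
  have hzw : ∀ w : ℂ, ‖w‖ ≤ R / 2 → R / 2 ≤ ‖z - w‖ := fun w hw => by
    have := norm_sub_norm_le z w
    linarith
  have hzne : ∀ w : ℂ, ‖w‖ ≤ R / 2 → z - w ≠ 0 := fun w hw => by
    rw [← norm_pos_iff]; linarith [hzw w hw]
  have hdiff : herglotzRieszKernel 0 y z - herglotzRieszKernel 0 x z =
      2 * z * (y - x) / ((z - y) * (z - x)) := by
    simp only [herglotzRieszKernel_def, sub_zero]
    have := hzne y hy
    have := hzne x hx
    field_simp
    ring
  have hbound : |(herglotzRieszKernel 0 y z).re - (herglotzRieszKernel 0 x z).re| ≤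
      8 * ‖y - x‖ / R := by
    rw [← Complex.sub_re, hdiff]
    refine (Complex.abs_re_le_norm _).trans ?_
    rw [norm_div, norm_mul, norm_mul, norm_mul, hz, Complex.norm_two]
    have h1 := hzw y hy
    have h2 := hzw x hx
    have h3 : R / 2 * (R / 2) ≤ ‖z - y‖ * ‖z - x‖ := by gcongr
    calc 2 * R * ‖y - x‖ / (‖z - y‖ * ‖z - x‖) ≤ 2 * R * ‖y - x‖ / (R / 2 * (R / 2)) := by
          gcongr
      _ = 8 * ‖y - x‖ / R := by field_simp; ring
  simp only [Pi.abs_apply, Pi.sub_apply, Pi.mul_apply, Function.comp, smul_eq_mul]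
  rw [← sub_mul, abs_mul]
  gcongr

end Real

/-! ### The proximity function of a shift quotient -/

namespace Function.locallyFinsuppWithin

lemma count_posPart_add_negPart (D : locallyFinsupp ℂ ℤ) {r : ℝ} (hr : 0 ≤ r) :
    (D⁺ + D⁻).count r = ∑ b ∈ D.ballSupport r, |(D b : ℝ)| := by
  have habs : ∀ b, ((D⁺ + D⁻) b : ℤ) = |D b| := fun b => by
    rw [coe_add, Pi.add_apply, posPart_apply, negPart_apply, posPart_add_negPart]
  have hS : (D⁺ + D⁻).ballSupport r = D.ballSupport r := by
    ext b
    rw [mem_ballSupport hr, mem_ballSupport hr, habs, ne_eq, abs_eq_zero]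
  rw [count, hS]
  refine Finset.sum_congr rfl fun b _ => ?_
  rw [habs, Int.cast_abs]

end Function.locallyFinsuppWithin

open Function.locallyFinsuppWithin Real ValueDistribution MeromorphicOn

/-- Factorization of a meromorphic function on a disk, on the level of `log ‖f‖`. -/
lemma Meromorphic.exists_log_norm_factorization {f : ℂ → ℂ} (hf : Meromorphic f)
    (ho : ∀ z, meromorphicOrderAt f z ≠ ⊤) {R : ℝ} (hR : 0 ≤ R) :
    ∃ g : ℂ → ℂ, AnalyticOnNhd ℂ g (closedBall 0 R) ∧ (∀ z ∈ closedBall (0 : ℂ) R, g z ≠ 0) ∧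
      ∀ᶠ x in codiscreteWithin (closedBall (0 : ℂ) R), log ‖f x‖ =
        ∑ b ∈ (divisor f Set.univ).ballSupport R, (divisor f Set.univ b : ℝ) * log ‖x - b‖
          + log ‖g x‖ := by
  obtain ⟨g, hg, hg0, hfg⟩ := (hf.meromorphicOn (s := closedBall 0 R)).extract_zeros_poles
    (fun u => ho u) ((divisor f _).finiteSupport (isCompact_closedBall 0 R))
  refine ⟨g, hg, fun z hz => hg0 ⟨z, hz⟩, ?_⟩
  filter_upwards [extract_zeros_poles_log hg0 hfg] with x hx
  rw [hx, Pi.add_apply]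
  congr 1
  rw [finsum_eq_sum_of_support_subset (s := (divisor f Set.univ).ballSupport R),
    Finset.sum_apply]
  · refine Finset.sum_congr rfl fun b hb => ?_
    have hb' := (mem_ballSupport hR).mp hb
    have : divisor f (closedBall 0 R) b = divisor f Set.univ b := by
      rw [divisor_apply hf.meromorphicOn (by simpa using hb'.1),
        divisor_apply hf.meromorphicOn (Set.mem_univ _)]
    simp [this]
  · intro b hb
    have h0 : divisor f (closedBall 0 R) b ≠ 0 := by
      intro h
      apply hb
      funext y
      simp [h]
    have hbR : b ∈ closedBall (0 : ℂ) R := (divisor f (closedBall 0 R)).supportWithinDomain h0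
    rw [divisor_apply hf.meromorphicOn hbR] at h0
    rw [Finset.mem_coe, mem_ballSupport hR, divisor_apply hf.meromorphicOn (Set.mem_univ _)]
    exact ⟨by simpa using hbR, h0⟩

/-- The mean of `|log ‖f‖|` on a circle. -/
lemma Meromorphic.circleAverage_abs_log_norm {f : ℂ → ℂ} (hf : Meromorphic f) (R : ℝ) :
    circleAverage (fun z => |log ‖f z‖|) 0 R = proximity f ⊤ R + proximity f⁻¹ ⊤ R := by
  rw [proximity_top, proximity_top, ← circleAverage_fun_add
    (hf.meromorphicOn.circleIntegrable_posLog_norm)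
    (hf.inv.meromorphicOn.circleIntegrable_posLog_norm)]
  congr 1
  funext z
  have h1 := posLog_sub_posLog_inv (x := ‖f z‖)
  have h2 := half_mul_log_add_log_abs (x := ‖f z‖)
  rw [Pi.inv_apply, norm_inv]
  linarith

/-- The mean of `|log ‖g‖|` for the zero-free factor `g` of `f`. -/
lemma circleAverage_abs_log_norm_le_of_factorization {f g : ℂ → ℂ} (hf : Meromorphic f) {R : ℝ}
    (hR : 1 ≤ R) (hg : AnalyticOnNhd ℂ g (closedBall 0 R))
    (hfg : ∀ᶠ x in codiscreteWithin (closedBall (0 : ℂ) R), log ‖f x‖ =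
        ∑ b ∈ (divisor f Set.univ).ballSupport R, (divisor f Set.univ b : ℝ) * log ‖x - b‖
          + log ‖g x‖) :
    circleAverage (fun z => |log ‖g z‖|) 0 R ≤ proximity f ⊤ R + proximity f⁻¹ ⊤ R +
      ((divisor f Set.univ)⁺ + (divisor f Set.univ)⁻).count R * log (4 * R) := by
  set D := divisor f Set.univ
  have hR0 : 0 < R := by linarith
  have hfi : CircleIntegrable (fun z => |log ‖f z‖|) 0 R :=
    hf.meromorphicOn.circleIntegrable_log_norm.abs
  have hgi : CircleIntegrable (fun z => |log ‖g z‖|) 0 R :=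
    (MeromorphicOn.circleIntegrable_log_norm fun z hz =>
      (hg z (by rw [abs_of_pos hR0] at hz; exact sphere_subset_closedBall hz)).meromorphicAt).abs
  have hbi : ∀ b ∈ D.ballSupport R,
      CircleIntegrable (fun z => |(D b : ℝ)| * |log ‖z - b‖|) 0 R := fun b _ =>
    (circleIntegrable_log_norm_sub b 0 R).abs.const_smul (a := |(D b : ℝ)|)
  have hsi : CircleIntegrable (fun z => ∑ b ∈ D.ballSupport R, |(D b : ℝ)| * |log ‖z - b‖|) 0 R :=
    CircleIntegrable.fun_sum _ hbi
  have hle : circleAverage (fun z => |log ‖g z‖|) 0 R ≤ circleAverage (fun z => |log ‖f z‖| +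
      ∑ b ∈ D.ballSupport R, |(D b : ℝ)| * |log ‖z - b‖|) 0 R := by
    refine circleAverage_mono_codiscreteWithin hR0.ne' hgi (hfi.add hsi) ?_
    rw [abs_of_pos hR0]
    filter_upwards [hfg.filter_mono (codiscreteWithin_mono sphere_subset_closedBall)] with x hx
    have h1 : log ‖g x‖ = log ‖f x‖ - ∑ b ∈ D.ballSupport R, (D b : ℝ) * log ‖x - b‖ := by
      rw [hx]; ring
    rw [h1]
    refine (abs_sub _ _).trans (add_le_add le_rfl ?_)
    refine (Finset.abs_sum_le_sum_abs _ _).trans (le_of_eq ?_)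
    exact Finset.sum_congr rfl fun b _ => abs_mul _ _
  refine hle.trans ?_
  rw [circleAverage_fun_add hfi hsi, hf.circleAverage_abs_log_norm, circleAverage_fun_sum hbi,
    count_posPart_add_negPart D hR0.le, Finset.sum_mul]
  refine add_le_add le_rfl (Finset.sum_le_sum fun b hb => ?_)
  have := circleAverage_fun_smul (a := |(D b : ℝ)|) (f := fun z => |log ‖z - b‖|) (c := 0) (R := R)
  simp only [smul_eq_mul] at this
  rw [this]
  exact mul_le_mul_of_nonneg_left
    (circleAverage_abs_log_norm_sub_le hR ((mem_ballSupport hR0.le).mp hb).1) (abs_nonneg _)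

/-- The contribution of a single zero or pole to the comparison of `f` with its shifts. -/
noncomputable def shiftDefect (c d : ℂ) (r : ℝ) (b x : ℂ) : ℝ :=
  4 * log (2 * (‖c‖ + ‖d‖) * (r + ‖b‖)) - 2 * log ‖x - b‖ - log ‖x - shiftPlus c d b‖
    - log ‖x - shiftMinus c d b‖

lemma circleIntegrable_shiftDefect (c d b : ℂ) (r : ℝ) :
    CircleIntegrable (shiftDefect c d r b) 0 r := by
  have h1 := circleIntegrable_log_norm_sub b 0 r
  have h2 := circleIntegrable_log_norm_sub (shiftPlus c d b) 0 r
  have h3 := circleIntegrable_log_norm_sub (shiftMinus c d b) 0 r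
  exact (((circleIntegrable_const _ _ _).sub (h1.const_smul (a := (2 : ℝ)))).sub h2).sub h3

/-- The four subtracted logarithms have means log max(r, |a|), with a equal to b (twice) or a shift
of b. Since r + |b| ≤ 3K max(r, |a|) in each case, they cancel the four leading logarithms up to log
(6K²) each, uniformly in r and b. -/
lemma circleAverage_shiftDefect_le {c d : ℂ} (hcd : c ^ 2 - d ^ 2 = 1) {r : ℝ} (hr : 1 ≤ r)
    (b : ℂ) : circleAverage (shiftDefect c d r b) 0 r ≤ 4 * log (6 * (‖c‖ + ‖d‖) ^ 2) := by
  have h1 := circleIntegrable_log_norm_sub b 0 r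
  have h2 := circleIntegrable_log_norm_sub (shiftPlus c d b) 0 r
  have h3 := circleIntegrable_log_norm_sub (shiftMinus c d b) 0 r
  have h1' : CircleIntegrable (fun x => 2 * log ‖x - b‖) 0 r := h1.const_smul (a := (2 : ℝ))
  have hK1 := one_le_norm_add_norm hcd
  set K := ‖c‖ + ‖d‖
  have hr0 : 0 < r := by linarith
  have hb := norm_nonneg b
  have ht : 0 < 2 * K * (r + ‖b‖) := by positivity
  have hA : 0 < 6 * K ^ 2 := by positivity
  have e : circleAverage (shiftDefect c d r b) 0 r =
      4 * log (2 * K * (r + ‖b‖)) - 2 * circleAverage (fun x => log ‖x - b‖) 0 r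
        - circleAverage (fun x => log ‖x - shiftPlus c d b‖) 0 r
        - circleAverage (fun x => log ‖x - shiftMinus c d b‖) 0 r := by
    have h0 : CircleIntegrable (fun _ : ℂ => 4 * log (2 * K * (r + ‖b‖))) 0 r :=
      circleIntegrable_const _ _ _
    have hs := circleAverage_fun_smul (a := (2 : ℝ)) (f := fun x => log ‖x - b‖) (c := 0) (R := r)
    simp only [smul_eq_mul] at hs
    have h01 : CircleIntegrable (fun x => 4 * log (2 * K * (r + ‖b‖)) - 2 * log ‖x - b‖) 0 r :=
      h0.sub h1'
    have h02 : CircleIntegrable (fun x => 4 * log (2 * K * (r + ‖b‖)) - 2 * log ‖x - b‖ -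
        log ‖x - shiftPlus c d b‖) 0 r := h01.sub h2
    unfold shiftDefect
    rw [circleAverage_fun_sub h02 h3, circleAverage_fun_sub h01 h2,
      circleAverage_fun_sub h0 h1', circleAverage_const, hs]
  have key : ∀ a : ℂ, r + ‖b‖ ≤ 3 * K * max r ‖a‖ →
      log (2 * K * (r + ‖b‖)) ≤ log (6 * K ^ 2) + circleAverage (fun x => log ‖x - a‖) 0 r := by
    intro a ha
    refine log_le_log_add_circleAverage hr0 hA ht ?_
    nlinarith
  have hmr : ∀ a : ℂ, r ≤ max r ‖a‖ := fun a => le_max_left _ _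
  have hma : ∀ a : ℂ, ‖a‖ ≤ max r ‖a‖ := fun a => le_max_right _ _
  have k1 := key b (by nlinarith [hmr b, hma b])
  have kk : ∀ a : ℂ, ‖b‖ ≤ K * (‖a‖ + 1) → r + ‖b‖ ≤ 3 * K * max r ‖a‖ := by
    intro a ha
    have hm0 : 0 < max r ‖a‖ := hr0.trans_le (hmr a)
    have : K * (‖a‖ + 1) ≤ K * (max r ‖a‖ + max r ‖a‖) := by
      gcongr
      · exact hma a
      · exact hr.trans (hmr a)
    nlinarith [hmr a]
  have k2 := key _ (kk _ (norm_le_of_shift_eq hcd (Or.inl rfl : shiftPlus c d b = _ ∨ _)))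
  have k3 := key _ (kk _ (norm_le_of_shift_eq hcd (Or.inr rfl : _ ∨ shiftMinus c d b = _)))
  rw [e]
  linarith

/-- Pointwise comparison of `log ‖· - b‖` at a point and at its shifts. -/
lemma abs_log_norm_shift_sub_le {c d : ℂ} (hcd : c ^ 2 - d ^ 2 = 1) {r : ℝ} (hr : 1 ≤ r)
    {x b : ℂ} (hx : ‖x‖ = r) (hxb : x ≠ b) (hp : shiftPlus c d x ≠ b)
    (hm : shiftMinus c d x ≠ b) :
    |log ‖shiftPlus c d x - b‖ - log ‖x - b‖| + |log ‖shiftMinus c d x - b‖ - log ‖x - b‖| ≤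
      shiftDefect c d r b x := by
  have hK1 := one_le_norm_add_norm hcd
  -- Symmetry moves the shift from the variable x to the constant b, where Jensen's formula applies.
  have hprod : log ‖shiftPlus c d x - b‖ + log ‖shiftMinus c d x - b‖ =
      log ‖x - shiftPlus c d b‖ + log ‖x - shiftMinus c d b‖ := by
    have h := shiftPlus_sub_mul_shiftMinus_sub hcd x b
    have h0 : (shiftPlus c d x - b) * (shiftMinus c d x - b) ≠ 0 :=
      mul_ne_zero (sub_ne_zero.mpr hp) (sub_ne_zero.mpr hm)
    have h1 := h0
    rw [h] at h1
    rw [← log_mul (norm_ne_zero_iff.mpr (left_ne_zero_of_mul h0))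
      (norm_ne_zero_iff.mpr (right_ne_zero_of_mul h0)),
      ← log_mul (norm_ne_zero_iff.mpr (left_ne_zero_of_mul h1))
      (norm_ne_zero_iff.mpr (right_ne_zero_of_mul h1)), ← norm_mul, ← norm_mul, h]
  have hb := norm_nonneg b
  have hbd : ∀ y : ℂ, ‖y‖ ≤ (‖c‖ + ‖d‖) * (r + 1) → y ≠ b →
      log ‖y - b‖ ≤ log (2 * (‖c‖ + ‖d‖) * (r + ‖b‖)) := by
    intro y hy hyb
    refine log_le_log (norm_pos_iff.mpr (sub_ne_zero.mpr hyb)) ((norm_sub_le _ _).trans ?_)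
    nlinarith
  have b1 := hbd x (by rw [hx]; nlinarith) hxb
  have b2 := hbd _ (hx ▸ norm_shiftPlus_le x) hp
  have b3 := hbd _ (hx ▸ norm_shiftMinus_le x) hm
  have tri : ∀ A B L : ℝ, A ≤ L → B ≤ L → |A - B| ≤ (L - A) + (L - B) := by
    intro A B L hA hB
    rw [abs_le]
    constructor <;> linarith
  have t1 := tri _ _ _ b2 b1
  have t2 := tri _ _ _ b3 b1
  rw [shiftDefect]
  linarith

lemma eventually_shift_mem_of_mem_codiscreteWithin {c d : ℂ} (hcd : c ^ 2 - d ^ 2 = 1) {r R : ℝ}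
    (hr : 1 ≤ r) (hrR : 2 * (‖c‖ + ‖d‖) * r ≤ R) {G : Set ℂ}
    (hG : G ∈ codiscreteWithin (closedBall (0 : ℂ) R)) :
    ∀ᶠ x in codiscreteWithin (sphere (0 : ℂ) r),
      x ∈ G ∧ shiftPlus c d x ∈ G ∧ shiftMinus c d x ∈ G := by
  have hK1 := one_le_norm_add_norm hcd
  have hbad := (isCompact_closedBall (0 : ℂ) R).finite_sdiff_of_mem_codiscreteWithin hG
  have hfin := (hbad.union (finite_shift_preimage hcd hbad)).compl_mem_codiscrete
  filter_upwards [codiscreteWithin_mono (Set.subset_univ _) hfin,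
    self_mem_codiscreteWithin (sphere (0 : ℂ) r)] with x hx hxr
  rw [mem_sphere_zero_iff_norm] at hxr
  have hball : ∀ y : ℂ, ‖y‖ ≤ (‖c‖ + ‖d‖) * (r + 1) → y ∈ closedBall (0 : ℂ) R := by
    intro y hy
    rw [mem_closedBall_zero_iff]
    nlinarith
  have h1 := hball x (by rw [hxr]; nlinarith)
  have h2 := hball (shiftPlus c d x) (hxr ▸ norm_shiftPlus_le x)
  have h3 := hball (shiftMinus c d x) (hxr ▸ norm_shiftMinus_le x)
  simp only [Set.mem_compl_iff, Set.mem_union, Set.mem_sdiff, Set.mem_ofPred_eq, not_or, not_and,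
    not_not] at hx
  exact ⟨hx.1 h1, hx.2.1 h2, hx.2.2 h3⟩

/-- Pointwise bound for a shift quotient in terms of the values at the shifted points. -/
lemma IsShiftQuotient.posLog_norm_le {c d : ℂ} {f F : ℂ → ℂ} (hF : IsShiftQuotient c d f F)
    {x : ℂ} (hx : 2 ≤ ‖x‖) (hxd : 1 ≤ ‖d‖ * ‖x‖) :
    log⁺ ‖F x‖ ≤ log⁺ ‖f (shiftPlus c d x)‖ + log⁺ ‖f (shiftMinus c d x)‖ + log 2 := by
  have hw : ‖x‖ / 2 ≤ ‖sqrtBranch x‖ := by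
    have h1 : ‖x‖ ^ 2 - 1 ≤ ‖sqrtBranch x‖ ^ 2 := by
      rw [← norm_pow, ← norm_pow, sqrtBranch_sq]
      simpa [-norm_pow] using norm_sub_norm_le (x ^ 2) 1
    refine le_of_sq_le_sq ?_ (norm_nonneg _)
    nlinarith
  have hw0 : sqrtBranch x ≠ 0 := by
    rw [← norm_pos_iff]; linarith
  have hden : 1 ≤ ‖2 * d * sqrtBranch x‖ := by
    rw [norm_mul, norm_mul, Complex.norm_two]
    nlinarith [norm_nonneg d]
  have hFx : ‖F x‖ ≤ ‖f (shiftPlus c d x) - f (shiftMinus c d x)‖ := by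
    rw [hF x _ hw0 (sqrtBranch_sq x), norm_div]
    exact div_le_self (norm_nonneg _) hden
  calc log⁺ ‖F x‖ ≤ log⁺ ‖f (shiftPlus c d x) - f (shiftMinus c d x)‖ :=
        posLog_le_posLog (norm_nonneg _) hFx
    _ ≤ _ := by
        have := posLog_norm_add_le (f (shiftPlus c d x)) (-f (shiftMinus c d x))
        rwa [norm_neg, ← sub_eq_add_neg] at this

/-- The proximity function of a shift quotient. -/
lemma IsShiftQuotient.proximity_top_le {c d : ℂ} (hcd : c ^ 2 - d ^ 2 = 1) (hd : d ≠ 0)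
    {f F : ℂ → ℂ} (hF : IsShiftQuotient c d f F) (hf : Meromorphic f)
    (ho : ∀ z, meromorphicOrderAt f z ≠ ⊤) :
    ∃ C, 0 ≤ C ∧ ∀ᶠ r : ℝ in atTop, proximity F ⊤ r ≤ 2 * proximity f ⊤ r
      + C * ((divisor f Set.univ)⁺ + (divisor f Set.univ)⁻).count (r ^ 2)
      + C * ((proximity f ⊤ (r ^ 2) + proximity f⁻¹ ⊤ (r ^ 2)) / r) + C := by
  have hK1 := one_le_norm_add_norm hcd
  set K := ‖c‖ + ‖d‖ with hK
  set D := divisor f Set.univ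
  have hlogK : 0 ≤ log (6 * K ^ 2) := log_nonneg (by nlinarith)
  -- The terms come from the defects of zeros and poles, from the zero-free factor, and from log 2.
  refine ⟨4 * log (6 * K ^ 2) + 192 * K + 1, by positivity, ?_⟩
  filter_upwards [eventually_ge_atTop 2, eventually_ge_atTop (4 * K),
    eventually_ge_atTop ‖d‖⁻¹] with r hr2 hrK hrd
  have hr1 : 1 ≤ r := by linarith
  have hr0 : 0 < r := by linarith
  have hd0 : 0 < ‖d‖ := norm_pos_iff.mpr hd
  have hdr : 1 ≤ ‖d‖ * r := by
    rw [inv_eq_one_div, div_le_iff₀ hd0] at hrd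
    linarith
  -- The shifts move x by O(r), so factoring on a disk of radius r² makes the Lipschitz factor
  -- O(r/R) = O(1/r).
  set R := r ^ 2 with hR
  have hR1 : 1 ≤ R := by nlinarith
  have hR0 : 0 < R := by linarith
  have hKR : 2 * K * r ≤ R / 2 := by nlinarith
  obtain ⟨g, hg, hg0, hfg⟩ := hf.exists_log_norm_factorization ho hR0.le
  set A := circleAverage (fun z => |log ‖g z‖|) 0 R with hA
  have hA0 : 0 ≤ A := circleAverage_nonneg_of_nonneg fun _ _ => abs_nonneg _
  have hAle := circleAverage_abs_log_norm_le_of_factorization hf hR1 hg hfg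
  set H := 24 * K * A / r with hH
  set Φ : ℂ → ℝ := fun x => 2 * log⁺ ‖f x‖ +
    ∑ b ∈ D.ballSupport R, |(D b : ℝ)| * shiftDefect c d r b x with hΦ
  -- the pointwise estimate
  have hpt : ∀ᶠ x in codiscreteWithin (sphere (0 : ℂ) r),
      log⁺ ‖F x‖ ≤ Φ x + (2 * H + log 2) := by
    have hS : ((D.ballSupport R : Set ℂ)ᶜ) ∈ codiscreteWithin (closedBall (0 : ℂ) R) :=
      codiscreteWithin_mono (Set.subset_univ _)
        (D.ballSupport R).finite_toSet.compl_mem_codiscrete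
    filter_upwards [eventually_shift_mem_of_mem_codiscreteWithin hcd hr1
      (by linarith : 2 * (‖c‖ + ‖d‖) * r ≤ R) (hfg.and hS),
      self_mem_codiscreteWithin (sphere (0 : ℂ) r)] with x hx hxr
    rw [mem_sphere_zero_iff_norm] at hxr
    obtain ⟨⟨ex, sx⟩, ⟨ep, sp⟩, ⟨em, sm⟩⟩ := hx
    have hF' := hF.posLog_norm_le (hxr ▸ hr2) (hxr ▸ hdr)
    have hxR : ‖x‖ ≤ R / 2 := by nlinarith
    have hdiff : ∀ y : ℂ, ‖y‖ ≤ K * (r + 1) → |log ‖g y‖ - log ‖g x‖| ≤ H := by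
      intro y hy
      have hyR : ‖y‖ ≤ R / 2 := by nlinarith
      have hyx : ‖y - x‖ ≤ 3 * K * r := (norm_sub_le _ _).trans (by rw [hxr]; nlinarith)
      refine (abs_log_norm_sub_log_norm_le hR0 hg hg0 hxR hyR).trans ?_
      calc 8 * ‖y - x‖ / R * A ≤ 8 * (3 * K * r) / R * A := by gcongr
        _ = H := by rw [hH, hR]; field_simp; ring
    have hcmp : ∀ y : ℂ, log ‖f y‖ = ∑ b ∈ D.ballSupport R, (D b : ℝ) * log ‖y - b‖
          + log ‖g y‖ → ‖y‖ ≤ K * (r + 1) →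
        log⁺ ‖f y‖ ≤ log⁺ ‖f x‖ +
          ∑ b ∈ D.ballSupport R, |(D b : ℝ)| * |log ‖y - b‖ - log ‖x - b‖| + H := by
      intro y hy hyr
      refine (posLog_le_posLog_add_abs ‖f y‖ ‖f x‖).trans ?_
      rw [add_assoc]
      refine add_le_add le_rfl ?_
      have e : log ‖f y‖ - log ‖f x‖ =
          ∑ b ∈ D.ballSupport R, (D b : ℝ) * (log ‖y - b‖ - log ‖x - b‖)
            + (log ‖g y‖ - log ‖g x‖) := by
        rw [hy, ex]
        simp only [mul_sub, Finset.sum_sub_distrib]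
        ring
      rw [e]
      refine (abs_add_le _ _).trans (add_le_add ?_ (hdiff y hyr))
      refine (Finset.abs_sum_le_sum_abs _ _).trans (le_of_eq ?_)
      exact Finset.sum_congr rfl fun b _ => abs_mul _ _
    have cp := hcmp _ ep (hxr ▸ norm_shiftPlus_le x)
    have cm := hcmp _ em (hxr ▸ norm_shiftMinus_le x)
    have hsum : ∑ b ∈ D.ballSupport R, |(D b : ℝ)| * |log ‖shiftPlus c d x - b‖ - log ‖x - b‖| +
        ∑ b ∈ D.ballSupport R, |(D b : ℝ)| * |log ‖shiftMinus c d x - b‖ - log ‖x - b‖| ≤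
        ∑ b ∈ D.ballSupport R, |(D b : ℝ)| * shiftDefect c d r b x := by
      rw [← Finset.sum_add_distrib]
      refine Finset.sum_le_sum fun b hb => ?_
      rw [← mul_add]
      refine mul_le_mul_of_nonneg_left ?_ (abs_nonneg _)
      exact abs_log_norm_shift_sub_le hcd hr1 hxr (fun h => sx (h ▸ hb)) (fun h => sp (h ▸ hb))
        (fun h => sm (h ▸ hb))
    simp only [hΦ]
    linarith
  -- integration
  have hFi : CircleIntegrable (fun x => log⁺ ‖F x‖) 0 r :=
    (hF.meromorphic hcd hd hf).meromorphicOn.circleIntegrable_posLog_norm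
  have hfi : CircleIntegrable (fun x => log⁺ ‖f x‖) 0 r :=
    hf.meromorphicOn.circleIntegrable_posLog_norm
  have hfi2 : CircleIntegrable (fun x => 2 * log⁺ ‖f x‖) 0 r := hfi.const_smul (a := (2 : ℝ))
  have hbi : ∀ b ∈ D.ballSupport R,
      CircleIntegrable (fun x => |(D b : ℝ)| * shiftDefect c d r b x) 0 r := fun b _ =>
    (circleIntegrable_shiftDefect c d b r).const_smul (a := |(D b : ℝ)|)
  have hsi : CircleIntegrable
      (fun x => ∑ b ∈ D.ballSupport R, |(D b : ℝ)| * shiftDefect c d r b x) 0 r :=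
    CircleIntegrable.fun_sum _ hbi
  have hΦi : CircleIntegrable Φ 0 r := hfi2.add hsi
  have hci : CircleIntegrable (fun _ : ℂ => 2 * H + log 2) 0 r := circleIntegrable_const _ _ _
  have hmono : proximity F ⊤ r ≤ circleAverage (fun x => Φ x + (2 * H + log 2)) 0 r := by
    rw [proximity_top]
    exact circleAverage_mono_codiscreteWithin hr0.ne' hFi (hΦi.add hci)
      (by rwa [abs_of_pos hr0])
  have hcount : ∑ b ∈ D.ballSupport R, |(D b : ℝ)| = (D⁺ + D⁻).count R :=
    (count_posPart_add_negPart D hR0.le).symm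
  have hsumle : circleAverage
      (fun x => ∑ b ∈ D.ballSupport R, |(D b : ℝ)| * shiftDefect c d r b x) 0 r ≤
      (D⁺ + D⁻).count R * (4 * log (6 * K ^ 2)) := by
    rw [circleAverage_fun_sum hbi, ← hcount, Finset.sum_mul]
    refine Finset.sum_le_sum fun b _ => ?_
    have := circleAverage_fun_smul (a := |(D b : ℝ)|) (f := shiftDefect c d r b) (c := 0) (R := r)
    simp only [smul_eq_mul] at this
    rw [this]
    exact mul_le_mul_of_nonneg_left (circleAverage_shiftDefect_le hcd hr1 b) (abs_nonneg _)
  have hsplit : circleAverage (fun x => Φ x + (2 * H + log 2)) 0 r ≤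
      2 * proximity f ⊤ r + (D⁺ + D⁻).count R * (4 * log (6 * K ^ 2)) + (2 * H + log 2) := by
    have h2 := circleAverage_fun_smul (a := (2 : ℝ)) (f := fun x => log⁺ ‖f x‖) (c := 0) (R := r)
    simp only [smul_eq_mul] at h2
    rw [circleAverage_fun_add hΦi hci, circleAverage_const, hΦ,
      circleAverage_fun_add hfi2 hsi, h2, proximity_top]
    linarith
  have hn : 0 ≤ (D⁺ + D⁻).count R :=
    count_nonneg (add_nonneg (posPart_nonneg D) (negPart_nonneg D)) R
  set n := (D⁺ + D⁻).count R
  set P := proximity f ⊤ R + proximity f⁻¹ ⊤ R with hP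
  have hP0 : 0 ≤ P := add_nonneg (proximity_nonneg _) (proximity_nonneg _)
  have hH2 : 2 * H ≤ 48 * K * (P / r) + 192 * K * n := by
    -- This crude bound suffices: the factor 1/r in H turns n log (4R) into O(n).
    have hlog : log (4 * R) ≤ 4 * r := by
      have h1 : log (4 * R) = 2 * log (2 * r) := by
        rw [hR, show 4 * r ^ 2 = (2 * r) ^ 2 by ring, log_pow]
        push_cast; ring
      have h2 := log_le_self (by positivity : 0 ≤ 2 * r)
      linarith
    have hA2 : A ≤ P + n * (4 * r) := hAle.trans (by gcongr)
    calc 2 * H = 48 * K * (A / r) := by rw [hH]; ring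
      _ ≤ 48 * K * ((P + n * (4 * r)) / r) := by gcongr
      _ = 48 * K * (P / r) + 192 * K * n := by field_simp; ring
  have hlog2 : log 2 ≤ 1 := by linarith [log_two_lt_d9]
  have hPr : 0 ≤ P / r := by positivity
  have hKn : 0 ≤ K * n := by positivity
  nlinarith [mul_nonneg hlogK hPr, mul_nonneg (by linarith : (0:ℝ) ≤ K) hPr]

/-! ### Growth of the characteristic function -/

lemma characteristic_eventually_le_of_logOrder_le {f : ℂ → ℂ} {σ : ℝ} (hσ : logOrder f ≤ σ)
    {ε : ℝ} (hε : 0 < ε) :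
    ∀ᶠ r : ℝ in atTop, characteristic f ⊤ r ≤ log r ^ (σ + ε) := by
  have hlt : logOrder f < ((σ + ε : ℝ) : EReal) :=
    hσ.trans_lt (by exact_mod_cast (by linarith : σ < σ + ε))
  have hll : ∀ᶠ r : ℝ in atTop, 0 < log (log r) :=
    (tendsto_log_atTop.comp tendsto_log_atTop).eventually_gt_atTop 0
  have hl : ∀ᶠ r : ℝ in atTop, 0 < log r := tendsto_log_atTop.eventually_gt_atTop 0
  filter_upwards [eventually_lt_of_limsup_lt hlt, hll, hl] with r hr hr1 hr2
  rw [EReal.coe_lt_coe_iff, div_lt_iff₀ hr1] at hr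
  rcases le_or_gt (characteristic f ⊤ r) 0 with h | h
  · exact h.trans (rpow_nonneg hr2.le _)
  · rw [rpow_def_of_pos hr2, ← exp_log h, mul_comm]
    exact exp_le_exp.mpr hr.le

lemma logOrder_le_of_characteristic_eventually_le {f : ℂ → ℂ} {σ M : ℝ} (hσ : 0 ≤ σ) (hM : 1 ≤ M)
    (h : ∀ ε > 0, ∀ᶠ r : ℝ in atTop, characteristic f ⊤ r ≤ M * log r ^ (σ + ε)) :
    logOrder f ≤ σ := by
  refine EReal.le_of_forall_lt_iff_le.mp fun z hz => ?_
  have hz' : σ < z := by exact_mod_cast hz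
  -- One half of the gap is spent on the exponent, the other on absorbing log M.
  set ε := (z - σ) / 2 with hε
  have hε0 : 0 < ε := by rw [hε]; linarith
  refine limsup_le_of_le (by isBoundedDefault) ?_
  have hll : ∀ᶠ r : ℝ in atTop, 1 + log M / ε ≤ log (log r) :=
    (tendsto_log_atTop.comp tendsto_log_atTop).eventually_ge_atTop _
  have hl : ∀ᶠ r : ℝ in atTop, 0 < log r := tendsto_log_atTop.eventually_gt_atTop 0
  filter_upwards [h ε hε0, hll, hl, eventually_ge_atTop 1] with r hr hr1 hr2 hr3
  have hlM : 0 ≤ log M / ε := div_nonneg (log_nonneg hM) hε0.le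
  have hl0 : 0 < log (log r) := by linarith
  rw [EReal.coe_le_coe_iff, div_le_iff₀ hl0]
  rcases (characteristic_nonneg (f := f) (a := ⊤) hr3).eq_or_lt with h0 | h0
  · rw [← h0, log_zero]
    exact mul_nonneg (by linarith) hl0.le
  · have h1 := log_le_log h0 hr
    rw [log_mul (by linarith) (rpow_pos_of_pos hr2 _).ne', log_rpow hr2] at h1
    have h2 : log M ≤ ε * log (log r) := by
      have : log M / ε ≤ log (log r) := by linarith
      rwa [div_le_iff₀ hε0, mul_comm] at this
    have h3 : z = σ + ε + ε := by rw [hε]; ring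
    rw [h3]
    linarith

lemma characteristic_inv_le {f : ℂ → ℂ} (hf : Meromorphic f) :
    ∃ C, 0 ≤ C ∧ ∀ r, characteristic f⁻¹ ⊤ r ≤ characteristic f ⊤ r + C := by
  refine ⟨max |log ‖f 0‖| |log ‖meromorphicTrailingCoeffAt f 0‖|,
    le_max_of_le_left (abs_nonneg _), fun r => ?_⟩
  have := abs_le.mp (characteristic_sub_characteristic_inv_le hf (R := r))
  linarith [this.1]

lemma logCounting_top_le_characteristic (f : ℂ → ℂ) (r : ℝ) :
    ValueDistribution.logCounting f ⊤ r ≤ characteristic f ⊤ r := by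
  have := proximity_nonneg (f := f) (a := ⊤) r
  simp only [characteristic, Pi.add_apply, Pi.zero_apply] at *
  linarith

lemma proximity_top_le_characteristic (f : ℂ → ℂ) {r : ℝ} (hr : 1 ≤ r) :
    proximity f ⊤ r ≤ characteristic f ⊤ r := by
  have := ValueDistribution.logCounting_nonneg (f := f) (e := ⊤) hr
  simp only [characteristic, Pi.add_apply]
  linarith

/-- The number of zeros and poles in the disk of radius `r²`. -/
lemma count_divisor_le_of_logOrder_le {f : ℂ → ℂ} (hf : Meromorphic f) {σ : ℝ}
    (hσ : logOrder f ≤ σ) {ε : ℝ} (hε : 0 < ε) :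
    ∃ C, 0 ≤ C ∧ ∀ᶠ r : ℝ in atTop,
      ((divisor f Set.univ)⁺ + (divisor f Set.univ)⁻).count (r ^ 2) ≤
        C * log r ^ (σ - 1 + ε) + C * log r := by
  obtain ⟨C₀, hC₀, hinv⟩ := characteristic_inv_le hf
  refine ⟨max (4 ^ (σ + ε)) C₀, le_max_of_le_right hC₀, ?_⟩
  have hT : ∀ᶠ r : ℝ in atTop, characteristic f ⊤ (r ^ 4) ≤ log (r ^ 4) ^ (σ + ε) :=
    (tendsto_pow_atTop (by norm_num)).eventually
      (characteristic_eventually_le_of_logOrder_le hσ hε)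
  have hl : ∀ᶠ r : ℝ in atTop, 1 ≤ log r := tendsto_log_atTop.eventually_ge_atTop 1
  filter_upwards [hT, hl, eventually_ge_atTop 1] with r hr hlr hr1
  set D := divisor f Set.univ
  have hD : 0 ≤ D⁺ + D⁻ := add_nonneg (posPart_nonneg D) (negPart_nonneg D)
  -- Division by the logarithm will lower the exponent σ + ε by one. The radius r⁴ only contributes
  -- the factor 4^(σ + ε).
  have h1 : (D⁺ + D⁻).count (r ^ 2) * log (r ^ 2) ≤
      ValueDistribution.logCounting f⁻¹ ⊤ (r ^ 4) + ValueDistribution.logCounting f ⊤ (r ^ 4) := by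
    have := count_mul_log_le hD (R := r ^ 2) (one_le_pow₀ hr1)
    rw [← pow_mul, map_add] at this
    rwa [logCounting_inv, logCounting_zero, logCounting_top]
  have h2 := logCounting_top_le_characteristic f⁻¹ (r ^ 4)
  have h3 := logCounting_top_le_characteristic f (r ^ 4)
  have h4 := hinv (r ^ 4)
  rw [log_pow] at h1 hr
  push_cast at h1 hr
  rw [mul_rpow (by norm_num) (by linarith)] at hr
  have h5 : log r ^ (σ + ε) = log r ^ (σ - 1 + ε) * log r := by
    rw [show σ + ε = (σ - 1 + ε) + 1 by ring, rpow_add_one (by linarith)]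
  have hp : 0 ≤ log r ^ (σ - 1 + ε) := rpow_nonneg (by linarith) _
  have h6 : (D⁺ + D⁻).count (r ^ 2) * log r ≤
      (4 ^ (σ + ε) * log r ^ (σ - 1 + ε) + C₀ * log r) * log r := by
    rw [h5] at hr
    have : C₀ ≤ C₀ * log r * log r := by
      have : 1 ≤ log r * log r := by nlinarith
      nlinarith
    nlinarith
  refine (le_of_mul_le_mul_right h6 (by linarith)).trans ?_
  gcongr
  · exact le_max_left _ _
  · exact le_max_right _ _

/-- The growth of the proximity functions on much larger circles is negligible. -/
lemma proximity_sq_div_le_of_logOrder_le {f : ℂ → ℂ} (hf : Meromorphic f) {σ : ℝ}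
    (hσ : logOrder f ≤ σ) :
    ∃ C, 0 ≤ C ∧ ∀ᶠ r : ℝ in atTop,
      (proximity f ⊤ (r ^ 2) + proximity f⁻¹ ⊤ (r ^ 2)) / r ≤ C := by
  obtain ⟨C₀, hC₀, hinv⟩ := characteristic_inv_le hf
  refine ⟨2 * 2 ^ (σ + 1) + C₀, by positivity, ?_⟩
  have hT : ∀ᶠ r : ℝ in atTop, characteristic f ⊤ (r ^ 2) ≤ log (r ^ 2) ^ (σ + 1) :=
    (tendsto_pow_atTop (by norm_num)).eventually
      (characteristic_eventually_le_of_logOrder_le hσ one_pos)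
  have hlo := (isLittleO_log_rpow_rpow_atTop (σ + 1) one_pos).bound one_pos
  filter_upwards [hT, hlo, eventually_ge_atTop 1] with r hr hlr hr1
  have hl0 : 0 ≤ log r := log_nonneg hr1
  rw [rpow_one, one_mul, norm_of_nonneg (rpow_nonneg hl0 _), norm_of_nonneg (by linarith)] at hlr
  rw [log_pow, mul_rpow (by norm_num) hl0] at hr
  push_cast at hr
  have h1 := proximity_top_le_characteristic f (one_le_pow₀ hr1 : 1 ≤ r ^ 2)
  have h2 := proximity_top_le_characteristic f⁻¹ (one_le_pow₀ hr1 : 1 ≤ r ^ 2)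
  have h3 := hinv (r ^ 2)
  have h4 : (2 : ℝ) ^ (σ + 1) * log r ^ (σ + 1) ≤ 2 ^ (σ + 1) * r := by gcongr
  rw [div_le_iff₀ (by linarith)]
  nlinarith

/-- A meromorphic function of infinite order at a point is constant. -/
lemma Meromorphic.eventuallyEq_codiscrete_zero {f : ℂ → ℂ} (hf : Meromorphic f) {z : ℂ}
    (hz : meromorphicOrderAt f z = ⊤) : f =ᶠ[codiscrete ℂ] 0 := by
  refine mem_codiscreteWithin_iff_forall_mem_nhdsNE.mpr fun x _ => ?_
  simp only [Set.compl_univ, Set.union_empty]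
  have hx : meromorphicOrderAt f x = ⊤ := by
    by_contra h
    exact (hf.meromorphicOn (s := Set.univ)).meromorphicOrderAt_ne_top_of_isPreconnected
      isPreconnected_univ (Set.mem_univ x) (Set.mem_univ z) h hz
  exact meromorphicOrderAt_eq_top_iff.mp hx

/-- The characteristic function of a nonconstant function grows at least like `log r`. -/
lemma Meromorphic.log_sub_le_characteristic {f : ℂ → ℂ} (hf : Meromorphic f)
    (hc : ¬ ∃ a : ℂ, f =ᶠ[codiscrete ℂ] fun _ => a) :
    ∃ C, ∀ᶠ r : ℝ in atTop, log r - C ≤ characteristic f ⊤ r := by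
  classical
  obtain ⟨z, hz⟩ := ((hf 0).eventually_analyticAt).exists
  set h : ℂ → ℂ := fun x => f x - f z with hh
  have hm : Meromorphic h := hf.sub (Meromorphic.const (f z))
  have hne : meromorphicOrderAt h z ≠ ⊤ := by
    intro htop
    refine hc ⟨f z, ?_⟩
    filter_upwards [hm.eventuallyEq_codiscrete_zero htop] with x hx
    exact sub_eq_zero.mp hx
  have han : AnalyticAt ℂ h z := hz.sub analyticAt_const
  have hpos : 0 < meromorphicOrderAt h z := by
    refine (tendsto_zero_iff_meromorphicOrderAt_pos (hm z)).mp ?_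
    have := han.continuousAt.tendsto
    rw [show h z = 0 by simp [hh]] at this
    exact this.mono_left nhdsWithin_le_nhds
  -- The single zero of f - f(z) at z already contributes log r - log ‖z‖ to the counting function
  -- of zeros; the first main theorem carries this over to f.
  have hdiv : single z 1 ≤ (divisor h Set.univ)⁺ := by
    intro x
    simp only [single_apply, posPart_apply]
    split_ifs with hx
    · rw [hx, divisor_apply hm.meromorphicOn (Set.mem_univ _)]
      refine le_trans ?_ (le_posPart _)
      lift meromorphicOrderAt h z to ℤ using hne with n
      simpa [Int.lt_iff_add_one_le] using (by exact_mod_cast hpos : 0 < n)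
    · exact posPart_nonneg _
  obtain ⟨C₀, _, hinv⟩ := characteristic_inv_le hm
  refine ⟨log ‖z‖ + C₀ + (log⁺ ‖f z‖ + log 2), ?_⟩
  filter_upwards [eventually_ge_atTop 1, eventually_ge_atTop ‖z‖] with r hr1 hr2
  have h1 := logCounting_le hdiv hr1
  rw [logCounting_single_eq_log_sub_const hr2, ← logCounting_zero, ← logCounting_inv] at h1
  have h2 := logCounting_top_le_characteristic h⁻¹ r
  have h3 := hinv r
  have h4 := abs_le.mp (abs_characteristic_sub_characteristic_shift_le (a₀ := f z) (r := r) hf)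
  push_cast at h1
  linarith [h4.1]

/-- If σ < 1, then T would be bounded by a power of log r below the first, against T ≥ log r - C.
The bound makes the term O(log r) harmless for the order. -/
lemma one_le_logOrder_of_nonconstant {f : ℂ → ℂ} (hf : Meromorphic f)
    (hc : ¬ ∃ a : ℂ, f =ᶠ[codiscrete ℂ] fun _ => a) {σ : ℝ} (hσ : logOrder f ≤ σ) : 1 ≤ σ := by
  by_contra hlt
  rw [not_le] at hlt
  obtain ⟨C, hC⟩ := hf.log_sub_le_characteristic hc
  have hε : 0 < (1 - σ) / 2 := by linarith
  have hT := characteristic_eventually_le_of_logOrder_le hσ hε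
  have hp : σ + (1 - σ) / 2 < 1 := by linarith
  have hlo := (tendsto_rpow_neg_atTop (sub_pos.mpr hp)).eventually
    (ge_mem_nhds (by norm_num : (0 : ℝ) < 1 / 2))
  have hlo' := tendsto_log_atTop.eventually hlo
  obtain ⟨r, h1, h2, h3, h4⟩ := (hC.and (hT.and (hlo'.and
    (tendsto_log_atTop.eventually_gt_atTop (max 0 (2 * C)))))).exists
  have h5 : 0 < log r := (le_max_left _ _).trans_lt h4
  have h6 : 2 * C < log r := (le_max_right _ _).trans_lt h4
  rw [neg_sub, rpow_sub_one h5.ne', div_le_iff₀ h5] at h3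
  linarith

/-! ### Constant functions, and assembly of the estimates -/

lemma logOrder_eq_zero_of_const {f : ℂ → ℂ} {a : ℂ} (h : f =ᶠ[codiscrete ℂ] fun _ => a) :
    logOrder f = 0 := by
  have ht : Tendsto (fun r : ℝ => ((log (log⁺ ‖a‖) / log (log r) : ℝ) : EReal)) atTop
      (𝓝 ((0 : ℝ) : EReal)) :=
    (continuous_coe_real_ereal.tendsto 0).comp
      (tendsto_const_nhds.div_atTop (tendsto_log_atTop.comp tendsto_log_atTop))
  rw [logOrder, ← EReal.coe_zero, ← ht.limsup_eq]
  refine limsup_congr ?_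
  filter_upwards [eventually_gt_atTop 0] with r hr
  rw [characteristic_congr_codiscrete h hr.ne']
  simp [characteristic]

lemma IsShiftQuotient.eventuallyEq_zero_of_const {c d : ℂ} (hcd : c ^ 2 - d ^ 2 = 1)
    {f F : ℂ → ℂ} (hF : IsShiftQuotient c d f F) {a : ℂ} (h : f =ᶠ[codiscrete ℂ] fun _ => a) :
    F =ᶠ[codiscrete ℂ] fun _ => 0 := by
  have hfin : ({1, -1} : Set ℂ).Finite := by simp
  filter_upwards [shift_preimage_mem_codiscrete hcd h, hfin.compl_mem_codiscrete] with x hx hx1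
  have hw : sqrtBranch x ≠ 0 := by
    intro h0
    have := sqrtBranch_sq x
    rw [h0] at this
    have h2 : x ^ 2 = 1 := by linear_combination -this
    exact hx1 (by simpa using h2)
  have e1 : f (c * x + d * sqrtBranch x) = a := hx.1
  have e2 : f (c * x - d * sqrtBranch x) = a := hx.2
  rw [hF x _ hw (sqrtBranch_sq x), e1, e2, sub_self, zero_div]

/-- Nevanlinna estimates for shift quotients of functions of finite logarithmic order. -/
lemma IsShiftQuotient.exists_logCounting_le_and_characteristic_le {c d : ℂ}
    (hcd : c ^ 2 - d ^ 2 = 1) (hd : d ≠ 0) {f F : ℂ → ℂ} (hF : IsShiftQuotient c d f F)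
    (hf : Meromorphic f) (ho : ∀ z, meromorphicOrderAt f z ≠ ⊤) {σ : ℝ} (hσ : logOrder f ≤ σ)
    {ε : ℝ} (hε : 0 < ε) :
    ∃ C, 0 ≤ C ∧ ∀ᶠ r : ℝ in atTop,
      ValueDistribution.logCounting F ⊤ r ≤ 2 * ValueDistribution.logCounting f ⊤ r
        + C * log r ^ (σ - 1 + ε) + C * log r ∧
      characteristic F ⊤ r ≤ 2 * characteristic f ⊤ r
        + C * log r ^ (σ - 1 + ε) + C * log r := by
  obtain ⟨C₁, hC₁, h₁⟩ := hF.logCounting_top_le hcd hd hf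
  obtain ⟨C₂, hC₂, h₂⟩ := hF.proximity_top_le hcd hd hf ho
  obtain ⟨C₃, hC₃, h₃⟩ := count_divisor_le_of_logOrder_le hf hσ hε
  obtain ⟨C₄, hC₄, h₄⟩ := proximity_sq_div_le_of_logOrder_le hf hσ
  refine ⟨(C₁ + C₂) * C₃ + C₁ + C₂ * C₄ + C₂, by positivity, ?_⟩
  have hl : ∀ᶠ r : ℝ in atTop, 1 ≤ log r := tendsto_log_atTop.eventually_ge_atTop 1
  filter_upwards [h₁, h₂, h₃, h₄, hl] with r g₁ g₂ g₃ g₄ hlr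
  set D := divisor f Set.univ
  have hle : D⁻.count (r ^ 2) ≤ (D⁺ + D⁻).count (r ^ 2) := by
    rw [count_add _ _ (sq_nonneg r)]
    linarith [count_nonneg (posPart_nonneg D) (r ^ 2)]
  set L := log r ^ (σ - 1 + ε) with hL
  have hL0 : 0 ≤ L := rpow_nonneg (by linarith) _
  have k₁ := mul_le_mul_of_nonneg_left (hle.trans g₃) hC₁
  have k₂ := mul_le_mul_of_nonneg_left g₃ hC₂
  have k₃ := mul_le_mul_of_nonneg_left g₄ hC₂
  have hN : ValueDistribution.logCounting F ⊤ r ≤ 2 * ValueDistribution.logCounting f ⊤ r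
      + C₁ * C₃ * L + (C₁ * C₃ + C₁) * log r := by
    linarith
  have hP : proximity F ⊤ r ≤ 2 * proximity f ⊤ r
      + C₂ * C₃ * L + (C₂ * C₃ + C₂ * C₄ + C₂) * log r := by
    nlinarith [mul_nonneg hC₂ hC₄]
  have p1 : 0 ≤ C₂ * C₃ * L := by positivity
  have p2 : 0 ≤ (C₁ + C₂ * C₄ + C₂) * L := by positivity
  have p3 : 0 ≤ (C₂ * C₃ + C₂ * C₄ + C₂) * log r := by positivity
  refine ⟨by nlinarith, ?_⟩
  simp only [characteristic, Pi.add_apply]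
  nlinarith

lemma IsShiftQuotient.logOrder_le {c d : ℂ}
    (hcd : c ^ 2 - d ^ 2 = 1) (hd : d ≠ 0) {f F : ℂ → ℂ} (hF : IsShiftQuotient c d f F)
    (hf : Meromorphic f) (ho : ∀ z, meromorphicOrderAt f z ≠ ⊤) {σ : ℝ} (hσ : logOrder f ≤ σ)
    (h1σ : 1 ≤ σ) : logOrder F ≤ σ := by
  refine EReal.le_of_forall_lt_iff_le.mp fun z hz => ?_
  have hz' : σ < z := by exact_mod_cast hz
  obtain ⟨C, hC, h⟩ := hF.exists_logCounting_le_and_characteristic_le hcd hd hf ho hσ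
    (sub_pos.mpr hz')
  -- The estimate is used with the fixed gap z - σ, so C does not depend on the inner ε. The 2 comes
  -- from 2T, and 2C from the two error terms.
  refine logOrder_le_of_characteristic_eventually_le (M := 2 + 2 * C) (by linarith) (by linarith)
    fun ε hε => ?_
  have hl : ∀ᶠ r : ℝ in atTop, 1 ≤ log r := tendsto_log_atTop.eventually_ge_atTop 1
  filter_upwards [h, hl, characteristic_eventually_le_of_logOrder_le hσ (sub_pos.mpr hz')]
    with r hr hlr hT
  have e1 : log r ^ (σ + (z - σ)) ≤ log r ^ (z + ε) :=
    rpow_le_rpow_of_exponent_le hlr (by linarith)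
  have e2 : log r ^ (σ - 1 + (z - σ)) ≤ log r ^ (z + ε) :=
    rpow_le_rpow_of_exponent_le hlr (by linarith)
  have e3 : log r ≤ log r ^ (z + ε) := by
    simpa using rpow_le_rpow_of_exponent_le hlr (by linarith : (1 : ℝ) ≤ z + ε)
  have e4 := mul_le_mul_of_nonneg_left e2 hC
  have e5 := mul_le_mul_of_nonneg_left e3 hC
  linarith [hr.2]

theorem theoremT (q s : ℂ) (hq0 : q ≠ 0) (hq1 : ‖q‖ < 1) (hs : s ^ 2 = q)
    (f : ℂ → ℂ) (hf : Meromorphic f) (σ : ℝ) (hσ : logOrder f = (σ : EReal)) :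
    Meromorphic (askeyWilson s f) ∧
    (∀ ε : ℝ, 0 < ε →
      (∃ C : ℝ, ∀ᶠ r : ℝ in Filter.atTop,
        ValueDistribution.logCounting (askeyWilson s f) ⊤ r ≤
          2 * ValueDistribution.logCounting f ⊤ r
            + C * Real.log r ^ (σ - 1 + ε) + C * Real.log r) ∧
      (∃ C : ℝ, ∀ᶠ r : ℝ in Filter.atTop,
        ValueDistribution.characteristic (askeyWilson s f) ⊤ r ≤
          2 * ValueDistribution.characteristic f ⊤ r
            + C * Real.log r ^ (σ - 1 + ε) + C * Real.log r)) ∧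
    logOrder (askeyWilson s f) ≤ logOrder f := by
  have hs0 : s ≠ 0 := by
    rintro rfl
    exact hq0 (by rw [← hs]; simp)
  have hcd : ((s + s⁻¹) / 2) ^ 2 - ((s - s⁻¹) / 2) ^ 2 = 1 := by
    field_simp
    ring
  have hd : (s - s⁻¹) / 2 ≠ 0 := by
    intro h
    have h1 : s ^ 2 = 1 := by
      field_simp at h
      linear_combination h
    rw [← hs, h1, norm_one] at hq1
    exact lt_irrefl _ hq1
  have hF := isShiftQuotient_askeyWilson s f
  refine ⟨hF.meromorphic hcd hd hf, ?_⟩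
  -- Constants, up to a discrete set, are set aside: the bound σ ≥ 1 fails for them, and the zero
  -- function has no factorization.
  by_cases hc : ∃ a : ℂ, f =ᶠ[codiscrete ℂ] fun _ => a
  · obtain ⟨a, ha⟩ := hc
    have h0 := hF.eventuallyEq_zero_of_const hcd ha
    refine ⟨fun ε _ => ⟨⟨0, ?_⟩, ⟨0, ?_⟩⟩, ?_⟩
    · filter_upwards [eventually_ge_atTop 1] with r hr
      rw [logCounting_congr_codiscrete h0]
      have := ValueDistribution.logCounting_nonneg (f := f) (e := ⊤) hr
      simpa using this
    · filter_upwards [eventually_ge_atTop 1] with r hr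
      rw [characteristic_congr_codiscrete h0 (by linarith)]
      have := characteristic_nonneg (f := f) (a := ⊤) hr
      simpa [characteristic] using this
    · rw [logOrder_eq_zero_of_const h0, logOrder_eq_zero_of_const ha]
  · have ho : ∀ z, meromorphicOrderAt f z ≠ ⊤ := fun z hz =>
      hc ⟨0, hf.eventuallyEq_codiscrete_zero hz⟩
    refine ⟨fun ε hε => ?_, ?_⟩
    · obtain ⟨C, _, h⟩ := hF.exists_logCounting_le_and_characteristic_le hcd hd hf ho hσ.le hε
      exact ⟨⟨C, h.mono fun r hr => hr.1⟩, ⟨C, h.mono fun r hr => hr.2⟩⟩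
    · rw [hσ]
      exact hF.logOrder_le hcd hd hf ho hσ.le (one_le_logOrder_of_nonconstant hf hc hσ.le)
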